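/- Let $S^1=\mathbb R/\mathbb Z$ with Lebesgue (Haar) probability measure $m$, and let $(T_\delta)_{\delta\in[0,1]}$ be a family of $C^2$ maps $T_\delta:S^1\to S^1$ with $|T_\delta'(x)|>1$ for all $x\in S^1$. Suppose there is $K\in\mathbb R$ such that $\|T_\delta-T_0\|_{C^2}\le K\delta$ for all $\delta\in[0,1]$, where $$\|T_\delta-T_0\|_{C^2}=\sup_x d\big(T_\delta(x),T_0(x)\big)+\sup_x|T_\delta'(x)-T_0'(x)|+\sup_x|T_\delta''(x)-T_0''(x)|$$ and $d$ is the quotient distance on $S^1$. Let $L_\delta$ be the transfer operator of $T_\delta$ acting on densities: for $f\in L^1(m)$, $L_\delta f$ is the density with respect to $m$ of the push-forward by $T_\delta$ of the signed measure $f\,dm$. Let $W^{1,1}$ be the space of absolutely continuous functions $f:S^1\to\mathbb R$, i.e. $f(x)=f(0)+\int_0^x f'(t)\,dt$ with $f'\in L^1$, with norm $\|f\|_{W^{1,1}}=\|f\|_1+\|f'\|_1$. Then: 1. There is a constant $C$ such that $\|(L_\delta-L_0)f\|_1\le C\delta\|f\|_{W^{1,1}}$ for all $\delta\in[0,1]$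 and all $f\in W^{1,1}$. 2. For every $\delta\in[0,1]$ the map $T_\delta$ has exactly one invariant probability density $h_\delta\in L^1(m)$ (i.e. $h_\delta\ge 0$, $\int h_\delta\,dm=1$, $L_\delta h_\delta=h_\delta$), up to equality almost everywhere, and $$\|h_0-h_\delta\|_1=O(\delta\log\delta)\qquad(\delta\to0^+).$$ -/

import Mathlib

open MeasureTheory Filter Topology Asymptotics
open scoped ENNReal

noncomputable section

/-- A `C²` expanding map of the circle `ℝ/ℤ`. The regularity and the derivative are read off on a
lift `ℝ → ℝ`; two continuous lifts differ by an integer constant, so derivatives of the lift do not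
depend on which lift is recorded. Both orientations are allowed. -/
structure ExpandingCircleMap where
  toFun : UnitAddCircle → UnitAddCircle
  lift : ℝ → ℝ
  coe_lift : ∀ x : ℝ, toFun (x : UnitAddCircle) = (lift x : UnitAddCircle)
  contDiff_lift : ContDiff ℝ 2 lift
  expanding : ∀ x : ℝ, 1 < |deriv lift x|

instance : CoeFun ExpandingCircleMap (fun _ => UnitAddCircle → UnitAddCircle) :=
  ⟨ExpandingCircleMap.toFun⟩

/-- The `C²` distance `‖T - S‖_{C²}`: the sum of the sup norms of `T - S` (measured with the
quotient norm of `ℝ/ℤ`), of `T' - S'` and of `T'' - S''`. -/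
def c2Dist (T S : ExpandingCircleMap) : ℝ≥0∞ :=
  (⨆ x : UnitAddCircle, ‖T x - S x‖ₑ)
    + (⨆ x : ℝ, ‖deriv T.lift x - deriv S.lift x‖ₑ)
    + (⨆ x : ℝ, ‖deriv (deriv T.lift) x - deriv (deriv S.lift) x‖ₑ)

/-- The transfer operator on densities: push the signed measure `f dm` forward by `T` and take the
density of the result with respect to Lebesgue measure `m` on the circle. -/
def transferOp (T : UnitAddCircle → UnitAddCircle) (f : UnitAddCircle → ℝ) :
    UnitAddCircle → ℝ :=
  SignedMeasure.rnDeriv (((volume : Measure UnitAddCircle).withDensityᵥ f).map T) volume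

theorem integrable_transferOp (T : UnitAddCircle → UnitAddCircle) (f : UnitAddCircle → ℝ) :
    Integrable (transferOp T f) volume :=
  SignedMeasure.integrable_rnDeriv _ _

/-- `f` is an absolutely continuous function on the circle with derivative `f' ∈ L¹`, that is,
`f ∈ W^{1,1}` with derivative `f'` (which is unique almost everywhere). -/
def HasW11Deriv (f f' : UnitAddCircle → ℝ) : Prop :=
  Integrable f' volume ∧
    ∀ x : ℝ, f (x : UnitAddCircle) = f 0 + ∫ t in (0 : ℝ)..x, f' (t : UnitAddCircle)

/-- The `L¹` norm on the circle (used for integrable functions). -/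
def l1Norm (f : UnitAddCircle → ℝ) : ℝ := ∫ x, |f x|

/-- `h` is a probability density in `L¹` which is invariant for `T`. -/
def IsInvariantDensity (T : UnitAddCircle → UnitAddCircle) (h : UnitAddCircle → ℝ) : Prop :=
  Integrable h volume ∧ 0 ≤ᵐ[volume] h ∧ ∫ x, h x = 1 ∧ transferOp T h =ᵐ[volume] h

end

/-!
Densities are tested against continuous functions, so that transfer is dual to composition. If
`|T'| ≥ lam > 1` and `|T''| ≤ B`, then for large `a` transfer by `T` maps the cone of nonnegative
densities with `|f'| ≤ a f` (weakly) into the cone of parameter `b = a / lam + B < a`. A density in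
the latter cone dominates a fixed fraction of its mass times the constant density, and stays in the
larger cone after this fraction is removed. Two densities of the same mass thus lose a definite
proportion of their distance at each step, which gives a unique invariant density in the cone and
exponential convergence to it, at a rate depending on `lam` and `B` only. Smooth densities lie in
a cone up to a constant, and they are dense, so the invariant density is unique in `L¹`.

For the perturbation, `ψ ∘ T - ψ ∘ S` is, up to a uniform error `O(ε)`, the derivative of `H / S'`,
where `H x` is the integral of `ψ` over the arc from `S x` to `T x`, of length at most `ε`.
Integrating by parts bounds `L_T f - L_S f` by `O(ε)` times the variation of `f`. Finally, if
`L_T g = g` and `L_S f = f`, then `f - g = L_T^n (f - g) - (L_T^n f - f)` has norm at most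
`2 q ^ n + n O(ε)`, and `n` of order `|log ε|` gives `O(ε log ε)`.
-/

noncomputable section

section Pairing

variable {X : Type*} [TopologicalSpace X]

/-- A continuous approximation of the sign of `v`. -/
def approxSign (v : C(X, ℝ)) {ε : ℝ} (hε : 0 < ε) : C(X, ℝ) :=
  ⟨fun x => v x / (|v x| + ε), v.continuous.div (v.continuous.abs.add continuous_const)
    fun x => (by positivity : 0 < |v x| + ε).ne'⟩

theorem abs_approxSign_le_one (v : C(X, ℝ)) {ε : ℝ} (hε : 0 < ε) (x : X) :
    |approxSign v hε x| ≤ 1 := by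
  have hden : 0 < |v x| + ε := by positivity
  change |v x / (|v x| + ε)| ≤ 1
  rw [abs_div, abs_of_pos hden, div_le_one hden]
  linarith

theorem abs_sub_le_mul_approxSign (v : C(X, ℝ)) {ε : ℝ} (hε : 0 < ε) (x : X) :
    |v x| - ε ≤ v x * approxSign v hε x := by
  have hden : 0 < |v x| + ε := by positivity
  change |v x| - ε ≤ v x * (v x / (|v x| + ε))
  rw [← mul_div_assoc, le_div_iff₀ hden, ← abs_mul_abs_self (v x)]
  nlinarith [sq_nonneg ε]

variable [CompactSpace X] [MeasurableSpace X] [BorelSpace X] {μ : Measure X}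

theorem integrable_coeFn_mul (f : Lp ℝ 1 μ) (ψ : C(X, ℝ)) :
    Integrable (fun x => f x * ψ x) μ :=
  (L1.integrable_coeFn f).mul_bdd ψ.continuous.aestronglyMeasurable
    (ae_of_all _ ψ.norm_coe_le_norm)

variable [IsFiniteMeasure μ]

/-- The bilinear pairing `(f, ψ) ↦ ∫ f ψ ∂μ` between integrable densities and continuous
observables. -/
def pairing : Lp ℝ 1 μ →L[ℝ] C(X, ℝ) →L[ℝ] ℝ :=
  ((ContinuousLinearMap.mul ℝ ℝ).lpPairing μ 1 ∞).bilinearComp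
    (.id ℝ _) (ContinuousMap.toLp ∞ μ ℝ)

theorem pairing_apply (f : Lp ℝ 1 μ) (ψ : C(X, ℝ)) : pairing f ψ = ∫ x, f x * ψ x ∂μ := by
  refine (ContinuousLinearMap.lpPairing_eq_integral _ f _).trans (integral_congr_ae ?_)
  filter_upwards [ContinuousMap.coeFn_toLp (p := ∞) (𝕜 := ℝ) μ ψ] with x hx
  exact congrArg (f x * ·) hx

theorem pairing_toL1 {f : X → ℝ} (hf : Integrable f μ) (ψ : C(X, ℝ)) :
    pairing (hf.toL1 f) ψ = ∫ x, f x * ψ x ∂μ := by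
  rw [pairing_apply]
  refine integral_congr_ae ?_
  filter_upwards [hf.coeFn_toL1] with x hx
  rw [hx]

theorem pairing_toLp (v ψ : C(X, ℝ)) :
    pairing (ContinuousMap.toLp 1 μ ℝ v) ψ = ∫ x, v x * ψ x ∂μ := by
  rw [pairing_apply]
  refine integral_congr_ae ?_
  filter_upwards [ContinuousMap.coeFn_toLp (p := 1) (𝕜 := ℝ) μ v] with x hx
  rw [hx]

theorem tendsto_pairing {ι : Type*} {l : Filter ι} {u : ι → Lp ℝ 1 μ} {f : Lp ℝ 1 μ}
    (h : Tendsto u l (𝓝 f)) (ψ : C(X, ℝ)) :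
    Tendsto (fun i => pairing (u i) ψ) l (𝓝 (pairing f ψ)) := by
  have hcont := ((pairing (μ := μ)).flip ψ).continuous
  simpa only [Function.comp_def, ContinuousLinearMap.flip_apply] using (hcont.tendsto f).comp h

theorem abs_pairing_le_of_abs_le (f : Lp ℝ 1 μ) {ψ : C(X, ℝ)} {c : ℝ} (h : ∀ x, |ψ x| ≤ c) :
    |pairing f ψ| ≤ c * ‖f‖ := by
  rw [pairing_apply, L1.norm_eq_integral_norm, ← integral_const_mul]
  refine abs_integral_le_integral_abs.trans (integral_mono (integrable_coeFn_mul f ψ).abs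
    ((L1.integrable_coeFn f).norm.const_mul c) fun x => ?_)
  rw [abs_mul, mul_comm]
  exact mul_le_mul_of_nonneg_right (h x) (abs_nonneg _)

theorem pairing_nonneg {f : Lp ℝ 1 μ} (hf : 0 ≤ f) {ψ : C(X, ℝ)} (hψ : 0 ≤ ψ) :
    0 ≤ pairing f ψ := by
  rw [pairing_apply]
  refine integral_nonneg_of_ae ?_
  filter_upwards [(Lp.coeFn_nonneg f).2 hf] with x hx using mul_nonneg hx (hψ x)

theorem pairing_mono {f : Lp ℝ 1 μ} (hf : 0 ≤ f) {ψ χ : C(X, ℝ)} (h : ψ ≤ χ) :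
    pairing f ψ ≤ pairing f χ := by
  simpa [sub_nonneg] using pairing_nonneg hf (sub_nonneg.2 h)

theorem abs_pairing_le_pairing {f : Lp ℝ 1 μ} (hf : 0 ≤ f) {ψ χ : C(X, ℝ)}
    (h : ∀ x, |ψ x| ≤ χ x) : |pairing f ψ| ≤ pairing f χ :=
  abs_le.2 ⟨by simpa using pairing_mono hf (ψ := -χ) fun x => (abs_le.1 (h x)).1,
    pairing_mono hf fun x => (abs_le.1 (h x)).2⟩

theorem norm_eq_pairing_one {f : Lp ℝ 1 μ} (hf : 0 ≤ f) : ‖f‖ = pairing f 1 := by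
  rw [L1.norm_eq_integral_norm, pairing_apply]
  refine integral_congr_ae ?_
  filter_upwards [(Lp.coeFn_nonneg f).2 hf] with x hx
  simpa using hx

theorem nonneg_of_norm_le_pairing_one {f : Lp ℝ 1 μ} (hf : ‖f‖ ≤ pairing f 1) : 0 ≤ f := by
  have hint := L1.integrable_coeFn f
  have hdefect : ∀ x, 0 ≤ |f x| - f x := fun x => sub_nonneg.2 (le_abs_self _)
  have hzero : ∫ x, (|f x| - f x) ∂μ = 0 := by
    refine le_antisymm ?_ (integral_nonneg hdefect)
    rw [integral_sub hint.abs hint, sub_nonpos]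
    simpa [L1.norm_eq_integral_norm, pairing_apply] using hf
  rw [← Lp.coeFn_nonneg]
  filter_upwards [(integral_eq_zero_iff_of_nonneg hdefect (hint.abs.sub hint)).1 hzero] with x hx
  exact abs_eq_self.1 (sub_eq_zero.1 hx)

theorem norm_toLp_le_pairing_approxSign (v : C(X, ℝ)) {ε : ℝ} (hε : 0 < ε) :
    ‖ContinuousMap.toLp 1 μ ℝ v‖ ≤
      pairing (ContinuousMap.toLp 1 μ ℝ v) (approxSign v hε) + ε * μ.real Set.univ := by
  have hint : ∀ w : C(X, ℝ), Integrable w μ := fun w =>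
    w.continuous.integrable_of_hasCompactSupport (.of_compactSpace _)
  have hnorm : ‖ContinuousMap.toLp 1 μ ℝ v‖ = ∫ x, |v x| ∂μ := by
    rw [L1.norm_eq_integral_norm]
    refine integral_congr_ae ?_
    filter_upwards [ContinuousMap.coeFn_toLp (p := 1) (𝕜 := ℝ) μ v] with x hx
    rw [hx, Real.norm_eq_abs]
  have hmono : ∫ x, (|v x| - ε) ∂μ ≤ ∫ x, v x * approxSign v hε x ∂μ :=
    integral_mono ((hint v).abs.sub (integrable_const _)) (hint (v * approxSign v hε))
      (abs_sub_le_mul_approxSign v hε)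
  rw [integral_sub (hint v).abs (integrable_const _), integral_const, smul_eq_mul] at hmono
  rw [hnorm, pairing_toLp]
  linarith

variable [NormalSpace X] [μ.WeaklyRegular]

theorem norm_le_of_forall_pairing_le {f : Lp ℝ 1 μ} {B : ℝ}
    (h : ∀ ψ : C(X, ℝ), (∀ x, |ψ x| ≤ 1) → pairing f ψ ≤ B) : ‖f‖ ≤ B := by
  refine le_of_forall_pos_le_add fun ε hε => ?_
  set m := μ.real Set.univ
  have hm : 0 ≤ m := measureReal_nonneg
  have hη : 0 < ε / (2 + m) := by positivity
  obtain ⟨v, hv⟩ := (ContinuousMap.toLp_denseRange ℝ μ ℝ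
    (p := 1) ENNReal.one_ne_top).exists_dist_lt f hη
  set g : Lp ℝ 1 μ := ContinuousMap.toLp 1 μ ℝ v
  have hdist : |pairing (f - g) (approxSign v hη)| ≤ 1 * ‖f - g‖ :=
    abs_pairing_le_of_abs_le _ (abs_approxSign_le_one v hη)
  rw [map_sub, sub_apply] at hdist
  calc ‖f‖ ≤ ‖f - g‖ + ‖g‖ := by simpa using norm_add_le (f - g) g
    _ ≤ ‖f - g‖ + (pairing g (approxSign v hη) + ε / (2 + m) * m) := by
        gcongr
        exact norm_toLp_le_pairing_approxSign v hη
    _ ≤ pairing f (approxSign v hη) + (2 * ‖f - g‖ + ε / (2 + m) * m) := by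
        linarith [(abs_le.1 hdist).1]
    _ ≤ B + (2 * (ε / (2 + m)) + ε / (2 + m) * m) := by
        rw [dist_eq_norm] at hv
        gcongr
        exact h _ (abs_approxSign_le_one v hη)
    _ = B + ε := by field_simp

theorem ext_pairing {f g : Lp ℝ 1 μ} (h : ∀ ψ : C(X, ℝ), pairing f ψ = pairing g ψ) : f = g := by
  rw [← sub_eq_zero, ← norm_le_zero_iff]
  refine norm_le_of_forall_pairing_le fun ψ _ => ?_
  rw [map_sub, sub_apply, h ψ, sub_self]

theorem nonneg_iff_forall_pairing_nonneg {f : Lp ℝ 1 μ} :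
    0 ≤ f ↔ ∀ ψ : C(X, ℝ), 0 ≤ ψ → 0 ≤ pairing f ψ := by
  refine ⟨fun hf ψ => pairing_nonneg hf, fun hf => nonneg_of_norm_le_pairing_one ?_⟩
  refine norm_le_of_forall_pairing_le fun ψ hψ => ?_
  simpa using hf (1 - ψ) fun x => by simpa using (abs_le.1 (hψ x)).2

end Pairing

section TransferOperator

/-- The Banach space of integrable densities on the circle. -/
abbrev CircleL1 : Type := Lp ℝ 1 (volume : Measure UnitAddCircle)

theorem norm_toL1_eq_l1Norm {f : UnitAddCircle → ℝ} (hf : Integrable f volume) :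
    ‖hf.toL1 f‖ = l1Norm f :=
  L1.norm_of_fun_eq_integral_norm hf

theorem l1Norm_sub_eq_norm_sub {f g : UnitAddCircle → ℝ} (hf : Integrable f volume)
    (hg : Integrable g volume) : l1Norm (fun x => f x - g x) = ‖hf.toL1 f - hg.toL1 g‖ := by
  rw [← Integrable.toL1_sub, norm_toL1_eq_l1Norm]
  rfl

theorem integral_withDensity_ofReal {α : Type*} [MeasurableSpace α] {μ : Measure α} {f : α → ℝ}
    (hf : AEMeasurable f μ) (h0 : 0 ≤ᵐ[μ] f) (ψ : α → ℝ) :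
    ∫ x, ψ x ∂μ.withDensity (fun x => ENNReal.ofReal (f x)) = ∫ x, f x * ψ x ∂μ := by
  rw [integral_withDensity_eq_integral_toReal_smul₀ hf.ennreal_ofReal
    (ae_of_all _ fun _ => ENNReal.ofReal_lt_top)]
  refine integral_congr_ae ?_
  filter_upwards [h0] with x hx
  rw [ENNReal.toReal_ofReal hx, smul_eq_mul]

variable {T : UnitAddCircle → UnitAddCircle} (hT : Measure.QuasiMeasurePreserving T volume volume)
  {f g : UnitAddCircle → ℝ}
include hT

theorem setIntegral_transferOp (hf : Integrable f volume) {s : Set UnitAddCircle}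
    (hs : MeasurableSet s) : ∫ x in s, transferOp T f x = ∫ x in T ⁻¹' s, f x := by
  have hmap : ∀ {t : Set UnitAddCircle}, MeasurableSet t →
      (volume.withDensityᵥ f).map T t = ∫ x in T ⁻¹' t, f x := fun ht => by
    rw [VectorMeasure.map_apply _ hT.measurable ht, withDensityᵥ_apply hf (hT.measurable ht)]
  have hac : (volume.withDensityᵥ f).map T ≪ᵥ
      (volume : Measure UnitAddCircle).toENNRealVectorMeasure := by
    refine VectorMeasure.AbsolutelyContinuous.mk fun t ht h0 => ?_
    rw [Measure.toENNRealVectorMeasure_apply_measurable ht] at h0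
    rw [hmap ht, Measure.restrict_zero_set (hT.preimage_null h0), integral_zero_measure]
  rw [← withDensityᵥ_apply (integrable_transferOp T f) hs, ← hmap hs]
  exact congrArg (· s) (SignedMeasure.withDensityᵥ_rnDeriv_eq _ _ hac)

theorem transferOp_nonneg (hf : Integrable f volume) (h0 : 0 ≤ᵐ[volume] f) :
    0 ≤ᵐ[volume] transferOp T f := by
  refine ae_nonneg_of_forall_setIntegral_nonneg (integrable_transferOp T f) fun s hs _ => ?_
  rw [setIntegral_transferOp hT hf hs]
  exact setIntegral_nonneg_of_ae h0

theorem transferOp_sub (hf : Integrable f volume) (hg : Integrable g volume) :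
    transferOp T (f - g) =ᵐ[volume] transferOp T f - transferOp T g := by
  have hLf := integrable_transferOp T f
  have hLg := integrable_transferOp T g
  refine (integrable_transferOp T _).ae_eq_of_forall_setIntegral_eq _ _ (hLf.sub hLg)
    fun s hs _ => ?_
  rw [setIntegral_transferOp hT (hf.sub hg) hs, integral_sub' hLf.integrableOn hLg.integrableOn,
    setIntegral_transferOp hT hf hs, setIntegral_transferOp hT hg hs,
    integral_sub' hf.integrableOn hg.integrableOn]

theorem withDensity_transferOp (hf : Integrable f volume) (h0 : 0 ≤ᵐ[volume] f) :
    volume.withDensity (fun x => ENNReal.ofReal (transferOp T f x)) =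
      (volume.withDensity fun x => ENNReal.ofReal (f x)).map T := by
  ext s hs
  rw [Measure.map_apply hT.measurable hs, withDensity_apply _ hs,
    withDensity_apply _ (hT.measurable hs),
    ← ofReal_integral_eq_lintegral_ofReal (integrable_transferOp T f).integrableOn
      (ae_restrict_of_ae (transferOp_nonneg hT hf h0)),
    ← ofReal_integral_eq_lintegral_ofReal hf.integrableOn (ae_restrict_of_ae h0),
    setIntegral_transferOp hT hf hs]

theorem integral_transferOp_mul_of_nonneg (hf : Integrable f volume) (h0 : 0 ≤ᵐ[volume] f)
    {ψ : UnitAddCircle → ℝ} (hψ : Measurable ψ) :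
    ∫ x, transferOp T f x * ψ x = ∫ x, f x * ψ (T x) := by
  rw [← integral_withDensity_ofReal (integrable_transferOp T f).aemeasurable
      (transferOp_nonneg hT hf h0), withDensity_transferOp hT hf h0,
    integral_map hT.measurable.aemeasurable hψ.aestronglyMeasurable,
    integral_withDensity_ofReal hf.aemeasurable h0 fun x => ψ (T x)]

theorem integral_transferOp_mul (hf : Integrable f volume) {ψ : UnitAddCircle → ℝ}
    (hψ : Measurable ψ) {c : ℝ} (hc : ∀ x, |ψ x| ≤ c) :
    ∫ x, transferOp T f x * ψ x = ∫ x, f x * ψ (T x) := by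
  have hpos : Integrable f⁺ volume := hf.pos_part
  have hneg : Integrable f⁻ volume := hf.neg_part
  have hint : ∀ {u : UnitAddCircle → ℝ} {χ : UnitAddCircle → ℝ}, Integrable u volume →
      Measurable χ → (∀ x, |χ x| ≤ c) → Integrable (fun x => u x * χ x) volume :=
    fun hu hχ h => hu.mul_bdd hχ.aestronglyMeasurable (ae_of_all _ h)
  have hLpos := hint (integrable_transferOp T f⁺) hψ hc
  have hLneg := hint (integrable_transferOp T f⁻) hψ hc
  have hψT : Measurable fun x => ψ (T x) := hψ.comp hT.measurable
  have hdecomp : ∀ x, f⁺ x - f⁻ x = f x := congrFun (posPart_sub_negPart f)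
  calc ∫ x, transferOp T f x * ψ x
      = ∫ x, (transferOp T f⁺ x * ψ x - transferOp T f⁻ x * ψ x) := by
        refine integral_congr_ae ?_
        have hsub := transferOp_sub hT hpos hneg
        rw [posPart_sub_negPart] at hsub
        filter_upwards [hsub] with x hx
        rw [hx, Pi.sub_apply, sub_mul]
    _ = ∫ x, (f⁺ x * ψ (T x) - f⁻ x * ψ (T x)) := by
        rw [integral_sub hLpos hLneg,
          integral_sub (hint hpos hψT fun x => hc _) (hint hneg hψT fun x => hc _),
          integral_transferOp_mul_of_nonneg hT hpos (ae_of_all _ (posPart_nonneg f)) hψ,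
          integral_transferOp_mul_of_nonneg hT hneg (ae_of_all _ (negPart_nonneg f)) hψ]
    _ = ∫ x, f x * ψ (T x) := by
        simp_rw [← sub_mul, hdecomp]

end TransferOperator

namespace ExpandingCircleMap

variable (T : ExpandingCircleMap)

theorem continuous_toFun : Continuous T := by
  have hlift : T.toFun ∘ ((↑) : ℝ → UnitAddCircle) = fun x => (T.lift x : UnitAddCircle) :=
    funext T.coe_lift
  refine (QuotientAddGroup.isQuotientMap_mk (N := AddSubgroup.zmultiples (1 : ℝ))).continuous_iff.2
    ?_
  change Continuous (T.toFun ∘ ((↑) : ℝ → UnitAddCircle))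
  rw [hlift]
  exact (AddCircle.continuous_mk' 1).comp T.contDiff_lift.continuous

theorem hasDerivAt_lift (x : ℝ) : HasDerivAt T.lift (deriv T.lift x) x :=
  (T.contDiff_lift.differentiable two_ne_zero x).hasDerivAt

theorem contDiff_deriv_lift : ContDiff ℝ 1 (deriv T.lift) :=
  (contDiff_succ_iff_deriv.1 (one_add_one_eq_two (R := WithTop ℕ∞) ▸ T.contDiff_lift)).2.2

theorem hasDerivAt_deriv_lift (x : ℝ) :
    HasDerivAt (deriv T.lift) (deriv (deriv T.lift) x) x :=
  (T.contDiff_deriv_lift.differentiable one_ne_zero x).hasDerivAt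

theorem continuous_deriv_deriv_lift : Continuous (deriv (deriv T.lift)) :=
  T.contDiff_deriv_lift.continuous_deriv le_rfl

theorem deriv_lift_ne_zero (x : ℝ) : deriv T.lift x ≠ 0 :=
  abs_pos.1 (zero_lt_one.trans (T.expanding x))

theorem antilipschitzWith_lift : AntilipschitzWith 1 T.lift := by
  refine AntilipschitzWith.of_le_mul_dist fun x y => ?_
  rw [NNReal.coe_one, one_mul]
  wlog hxy : x < y generalizing x y
  · rcases (not_lt.1 hxy).eq_or_lt with rfl | hyx
    · simp
    · rw [dist_comm x, dist_comm (T.lift x)]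
      exact this y x hyx
  obtain ⟨c, -, hc⟩ := exists_deriv_eq_slope T.lift hxy T.contDiff_lift.continuous.continuousOn
    (T.contDiff_lift.differentiable two_ne_zero).differentiableOn
  have hexp := T.expanding c
  rw [hc, abs_div, one_lt_div (abs_pos.2 (sub_pos.2 hxy).ne')] at hexp
  simpa only [Real.dist_eq, abs_sub_comm] using hexp.le

end ExpandingCircleMap

theorem volume_preimage_coe_eq_zero {s : Set UnitAddCircle} (hs : volume s = 0) :
    volume (((↑) : ℝ → UnitAddCircle) ⁻¹' s) = 0 := by
  have hcover : (((↑) : ℝ → UnitAddCircle) ⁻¹' s)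
      = ⋃ n : ℤ, (((↑) : ℝ → UnitAddCircle) ⁻¹' s) ∩ Set.Ioc (n : ℝ) (n + 1) := by
    rw [← Set.inter_iUnion, iUnion_Ioc_intCast, Set.inter_univ]
  rw [hcover]
  refine measure_iUnion_null fun n => ?_
  have hnull := (UnitAddCircle.measurePreserving_mk n).quasiMeasurePreserving.preimage_null hs
  rwa [Measure.restrict_apply₀' measurableSet_Ioc.nullMeasurableSet] at hnull

namespace ExpandingCircleMap

variable (T : ExpandingCircleMap)

theorem quasiMeasurePreserving : Measure.QuasiMeasurePreserving T volume volume := by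
  have hmeas : Measurable T := T.continuous_toFun.measurable
  refine ⟨hmeas, Measure.AbsolutelyContinuous.mk fun s hs h0 => ?_⟩
  have hlift : volume (T.lift ⁻¹' (((↑) : ℝ → UnitAddCircle) ⁻¹' s)) = 0 := by
    have hle := T.antilipschitzWith_lift.hausdorffMeasure_preimage_le zero_le_one
      (((↑) : ℝ → UnitAddCircle) ⁻¹' s)
    rw [hausdorffMeasure_real, volume_preimage_coe_eq_zero h0, mul_zero] at hle
    exact le_antisymm hle zero_le
  have hpre : ((↑) : ℝ → UnitAddCircle) ⁻¹' (T ⁻¹' s) =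
      T.lift ⁻¹' (((↑) : ℝ → UnitAddCircle) ⁻¹' s) := by
    ext x
    simp only [Set.mem_preimage, T.coe_lift]
  rw [Measure.map_apply hmeas hs,
    ← (UnitAddCircle.measurePreserving_mk 0).measure_preimage (hmeas hs).nullMeasurableSet, hpre]
  exact Measure.restrict_le_self.absolutelyContinuous hlift

/-- The Koopman operator `ψ ↦ ψ ∘ T` on continuous observables. -/
def koopman (ψ : C(UnitAddCircle, ℝ)) : C(UnitAddCircle, ℝ) :=
  ψ.comp ⟨T, T.continuous_toFun⟩

@[simp]
theorem koopman_apply (ψ : C(UnitAddCircle, ℝ)) (x : UnitAddCircle) :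
    T.koopman ψ x = ψ (T x) := rfl

theorem koopman_one : T.koopman 1 = 1 := rfl

theorem pairing_toL1_transferOp {f : UnitAddCircle → ℝ} (hf : Integrable f volume)
    (ψ : C(UnitAddCircle, ℝ)) :
    pairing ((integrable_transferOp T f).toL1 _) ψ = pairing (hf.toL1 f) (T.koopman ψ) := by
  rw [pairing_toL1, pairing_toL1, integral_transferOp_mul T.quasiMeasurePreserving hf
    ψ.continuous.measurable ψ.norm_coe_le_norm]
  rfl

theorem pairing_toL1_transferOp_coeFn (f : CircleL1) (ψ : C(UnitAddCircle, ℝ)) :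
    pairing ((integrable_transferOp T f).toL1 _) ψ = pairing f (T.koopman ψ) := by
  rw [T.pairing_toL1_transferOp (L1.integrable_coeFn f), Integrable.toL1_coeFn]

/-- The transfer operator as a bounded operator on `L¹`, dual to the Koopman operator. -/
def transfer : CircleL1 →L[ℝ] CircleL1 :=
  LinearMap.mkContinuous
    { toFun := fun f => (integrable_transferOp T f).toL1 _
      map_add' := fun f g => ext_pairing fun ψ => by
        simp only [map_add, add_apply, pairing_toL1_transferOp_coeFn]
      map_smul' := fun c f => ext_pairing fun ψ => by
        simp only [map_smul, smul_apply, pairing_toL1_transferOp_coeFn, RingHom.id_apply] }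
    1 fun f => norm_le_of_forall_pairing_le fun ψ hψ => by
      rw [LinearMap.coe_mk, AddHom.coe_mk, pairing_toL1_transferOp_coeFn]
      exact (le_abs_self _).trans (abs_pairing_le_of_abs_le f fun x => hψ (T x))

theorem norm_transfer_le : ‖T.transfer‖ ≤ 1 :=
  LinearMap.mkContinuous_norm_le _ zero_le_one _

theorem pairing_transfer (f : CircleL1) (ψ : C(UnitAddCircle, ℝ)) :
    pairing (T.transfer f) ψ = pairing f (T.koopman ψ) :=
  T.pairing_toL1_transferOp_coeFn f ψ

theorem transfer_toL1 {f : UnitAddCircle → ℝ} (hf : Integrable f volume) :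
    T.transfer (hf.toL1 f) = (integrable_transferOp T f).toL1 _ :=
  ext_pairing fun ψ => by rw [pairing_transfer, pairing_toL1_transferOp]

theorem isInvariantDensity_iff {h : UnitAddCircle → ℝ} (hh : Integrable h volume) :
    IsInvariantDensity T h ↔
      0 ≤ hh.toL1 h ∧ pairing (hh.toL1 h) 1 = 1 ∧ T.transfer (hh.toL1 h) = hh.toL1 h := by
  have hnonneg : 0 ≤ hh.toL1 h ↔ 0 ≤ᵐ[volume] h := by
    rw [← Lp.coeFn_nonneg]
    exact Filter.eventually_congr (hh.coeFn_toL1.mono fun x hx => by rw [hx])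
  rw [IsInvariantDensity, hnonneg, pairing_toL1, T.transfer_toL1 hh, Integrable.toL1_eq_toL1_iff]
  simp only [hh, true_and, ContinuousMap.one_apply, mul_one]

end ExpandingCircleMap

section CircleDeriv

/-- The continuous function on the circle induced by a continuous `1`-periodic function. -/
def circleMapOfPeriodic {g : ℝ → ℝ} (hg : Function.Periodic g 1) (hc : Continuous g) :
    C(UnitAddCircle, ℝ) :=
  ⟨hg.lift, (QuotientAddGroup.isQuotientMap_mk
    (N := AddSubgroup.zmultiples (1 : ℝ))).continuous_iff.2 hc⟩

theorem forall_unitAddCircle_iff {p : UnitAddCircle → Prop} :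
    (∀ x, p x) ↔ ∀ x : ℝ, p (x : UnitAddCircle) :=
  QuotientAddGroup.mk_surjective.forall

theorem continuous_comp_coe (ψ : C(UnitAddCircle, ℝ)) :
    Continuous fun y : ℝ => ψ (y : UnitAddCircle) :=
  ψ.continuous.comp (AddCircle.continuous_mk' 1)

theorem integrable_continuousMap (ψ : C(UnitAddCircle, ℝ)) : Integrable ψ volume :=
  ψ.continuous.integrable_of_hasCompactSupport (.of_compactSpace _)

/-- `φ'` is the derivative of `φ` on the circle. -/
def IsCircleDeriv (φ φ' : C(UnitAddCircle, ℝ)) : Prop :=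
  ∀ x : ℝ, HasDerivAt (fun y : ℝ => φ (y : UnitAddCircle)) (φ' (x : UnitAddCircle)) x

namespace IsCircleDeriv

variable {φ φ' χ χ' : C(UnitAddCircle, ℝ)}

theorem mul (h : IsCircleDeriv φ φ') (k : IsCircleDeriv χ χ') :
    IsCircleDeriv (φ * χ) (φ' * χ + φ * χ') := fun x => (h x).mul (k x)

theorem add (h : IsCircleDeriv φ φ') (k : IsCircleDeriv χ χ') :
    IsCircleDeriv (φ + χ) (φ' + χ') := fun x => (h x).add (k x)

theorem const (c : ℝ) : IsCircleDeriv (ContinuousMap.const _ c) 0 :=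
  fun x => hasDerivAt_const x c

theorem integral_eq_zero (h : IsCircleDeriv φ φ') : ∫ x, φ' x = 0 := by
  rw [← UnitAddCircle.intervalIntegral_preimage 0, intervalIntegral.integral_eq_sub_of_hasDerivAt
    (fun x _ => h x) ((continuous_comp_coe φ').intervalIntegrable _ _),
    AddCircle.coe_add_period, sub_self]

theorem pairing_toLp_deriv (h : IsCircleDeriv φ φ') (k : IsCircleDeriv χ χ') :
    pairing (ContinuousMap.toLp 1 volume ℝ φ) χ' = -∫ x, φ' x * χ x := by
  have hsum := (h.mul k).integral_eq_zero
  have hadd := integral_add (integrable_continuousMap (φ' * χ)) (integrable_continuousMap (φ * χ'))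
  rw [pairing_toLp, eq_neg_iff_add_eq_zero, add_comm]
  exact hadd.symm.trans hsum

end IsCircleDeriv

end CircleDeriv

section LogLipschitz

/-- The weak derivative of `f` is a measure of total variation at most `V`. -/
def HasVariationLE (V : ℝ) (f : CircleL1) : Prop :=
  ∀ φ φ', IsCircleDeriv φ φ' → |pairing f φ'| ≤ V * ‖φ‖

theorem HasVariationLE.nonneg {V : ℝ} {f : CircleL1} (hf : HasVariationLE V f) : 0 ≤ V := by
  simpa using hf _ _ (IsCircleDeriv.const 1)

/-- Nonnegative densities whose logarithmic derivative is bounded by `a`, in the weak sense: the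
weak derivative of `f` is a measure bounded by `a f`. For fixed `a` they form a closed convex
cone. -/
structure LogLipschitz (a : ℝ) (f : CircleL1) : Prop where
  nonneg : 0 ≤ f
  deriv_le : ∀ φ φ', IsCircleDeriv φ φ' → |pairing f φ'| ≤ a * pairing f |φ|

namespace LogLipschitz

variable {a b : ℝ} {f : CircleL1}

theorem mono (hf : LogLipschitz a f) (hab : a ≤ b) : LogLipschitz b f where
  nonneg := hf.nonneg
  deriv_le φ φ' h := (hf.deriv_le φ φ' h).trans
    (mul_le_mul_of_nonneg_right hab (pairing_nonneg hf.nonneg (abs_nonneg φ)))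

theorem smul (hf : LogLipschitz a f) {c : ℝ} (hc : 0 ≤ c) : LogLipschitz a (c • f) where
  nonneg := nonneg_iff_forall_pairing_nonneg.2 fun ψ hψ => by
    rw [map_smul, smul_apply]
    exact smul_nonneg hc (pairing_nonneg hf.nonneg hψ)
  deriv_le φ φ' h := by
    simp only [map_smul, smul_apply, smul_eq_mul, abs_mul, abs_of_nonneg hc, mul_left_comm a]
    exact mul_le_mul_of_nonneg_left (hf.deriv_le φ φ' h) hc

theorem of_tendsto {u : ℕ → CircleL1} (hu : ∀ n, LogLipschitz a (u n))
    (h : Tendsto u atTop (𝓝 f)) : LogLipschitz a f where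
  nonneg := nonneg_iff_forall_pairing_nonneg.2 fun ψ hψ =>
    ge_of_tendsto' (tendsto_pairing h ψ) fun n => pairing_nonneg (hu n).nonneg hψ
  deriv_le φ φ' hφ := le_of_tendsto_of_tendsto' (tendsto_pairing h φ').abs
    ((tendsto_pairing h |φ|).const_mul a) fun n => (hu n).deriv_le φ φ' hφ

theorem hasVariationLE (hf : LogLipschitz a f) (ha : 0 ≤ a) : HasVariationLE (a * ‖f‖) f := by
  intro φ φ' h
  have hφ : |pairing f (|φ|)| ≤ ‖φ‖ * ‖f‖ := abs_pairing_le_of_abs_le f fun x => by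
    simpa using φ.norm_coe_le_norm x
  calc |pairing f φ'| ≤ a * pairing f |φ| := hf.deriv_le φ φ' h
    _ ≤ a * (‖φ‖ * ‖f‖) := mul_le_mul_of_nonneg_left ((le_abs_self _).trans hφ) ha
    _ = a * ‖f‖ * ‖φ‖ := by ring

end LogLipschitz

theorem IsCircleDeriv.logLipschitz_toLp {φ φ' : C(UnitAddCircle, ℝ)} (h : IsCircleDeriv φ φ')
    {a : ℝ} (h0 : 0 ≤ φ) (ha : ∀ x, |φ' x| ≤ a * φ x) :
    LogLipschitz a (ContinuousMap.toLp 1 volume ℝ φ) where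
  nonneg := nonneg_iff_forall_pairing_nonneg.2 fun ψ hψ => by
    rw [pairing_toLp]
    exact integral_nonneg fun x => mul_nonneg (h0 x) (hψ x)
  deriv_le χ χ' hχ := by
    rw [h.pairing_toLp_deriv hχ, abs_neg, pairing_toLp, ← integral_const_mul]
    refine abs_integral_le_integral_abs.trans (integral_mono
      (integrable_continuousMap (φ' * χ)).abs
      ((integrable_continuousMap (φ * |χ|)).const_mul a) fun x => ?_)
    simp only [abs_mul, ContinuousMap.abs_apply, ← mul_assoc]
    exact mul_le_mul_of_nonneg_right (ha x) (abs_nonneg _)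

/-- The constant density `1`. -/
def uniformDensity : CircleL1 := ContinuousMap.toLp 1 volume ℝ 1

theorem pairing_uniformDensity (ψ : C(UnitAddCircle, ℝ)) :
    pairing uniformDensity ψ = ∫ x, ψ x := by
  simp only [uniformDensity, pairing_toLp, ContinuousMap.one_apply, one_mul]

theorem pairing_uniformDensity_one : pairing uniformDensity 1 = 1 := by
  simp [pairing_uniformDensity, measureReal_def]

theorem logLipschitz_uniformDensity {a : ℝ} (ha : 0 ≤ a) : LogLipschitz a uniformDensity :=
  (IsCircleDeriv.const 1).logLipschitz_toLp zero_le_one fun x => by simpa using ha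

end LogLipschitz

section Minorization

variable (a : ℝ) (ψ : C(UnitAddCircle, ℝ)) (x : ℝ)

/-- The average of `ψ` over a full turn starting at `x`, with weight `exp (-a t)` at time `t`. It is
the solution on the circle of `φ' = a φ - (1 - exp (-a)) ψ`. -/
def expAverage : C(UnitAddCircle, ℝ) where
  toFun x := ∫ t in (0 : ℝ)..1, Real.exp (-(a * t)) * ψ (x + t)
  continuous_toFun := intervalIntegral.continuous_parametric_intervalIntegral_of_continuous' (by
    have := AddCircle.continuous_mk' (1 : ℝ)
    fun_prop) 0 1

theorem expAverage_coe : expAverage a ψ x =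
    Real.exp (a * x) * ∫ y in x..x + 1, Real.exp (-(a * y)) * ψ (y : UnitAddCircle) := by
  have hshift := intervalIntegral.integral_comp_add_left (a := 0) (b := 1)
    (fun y : ℝ => Real.exp (-(a * y)) * ψ (y : UnitAddCircle)) x
  rw [add_zero] at hshift
  rw [← hshift, ← intervalIntegral.integral_const_mul]
  refine intervalIntegral.integral_congr fun t _ => ?_
  simp only [AddCircle.coe_add, ← mul_assoc, ← Real.exp_add]
  ring_nf

theorem isCircleDeriv_expAverage :
    IsCircleDeriv (expAverage a ψ) (a • expAverage a ψ - (1 - Real.exp (-a)) • ψ) := by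
  intro x
  set k : ℝ → ℝ := fun y => Real.exp (-(a * y)) * ψ (y : UnitAddCircle) with hk
  have hc : Continuous k :=
    (by fun_prop : Continuous fun y : ℝ => Real.exp (-(a * y))).mul (continuous_comp_coe ψ)
  have hprim : ∀ z, HasDerivAt (fun u => ∫ y in (0 : ℝ)..u, k y) (k z) z := fun z =>
    (hc.integral_hasStrictDerivAt 0 z).hasDerivAt
  have hwindow : HasDerivAt (fun u => ∫ y in u..u + 1, k y) (k (x + 1) - k x) x := by
    refine (((hprim (x + 1)).comp_add_const x 1).sub (hprim x)).congr_of_eventuallyEq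
      (.of_forall fun u => ?_)
    exact (intervalIntegral.integral_interval_sub_left (hc.intervalIntegrable _ _)
      (hc.intervalIntegrable _ _)).symm
  have hexp : HasDerivAt (fun u => Real.exp (a * u)) (Real.exp (a * x) * a) x := by
    simpa using ((hasDerivAt_id x).const_mul a).exp
  rw [funext fun u => expAverage_coe a ψ u]
  refine (hexp.mul hwindow).congr_deriv ?_
  have hstart : Real.exp (a * x) * Real.exp (-(a * x)) = 1 := by simp [← Real.exp_add]
  have hend : Real.exp (a * x) * Real.exp (-(a * (x + 1))) = Real.exp (-a) := by
    rw [← Real.exp_add]; ring_nf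
  simp only [ContinuousMap.sub_apply, ContinuousMap.smul_apply, smul_eq_mul, expAverage_coe,
    hk, AddCircle.coe_add_period]
  linear_combination ψ (x : UnitAddCircle) * hend - ψ (x : UnitAddCircle) * hstart

variable {a ψ}

theorem exp_mul_integral_le_expAverage (ha : 0 ≤ a) (hψ : 0 ≤ ψ) (x : UnitAddCircle) :
    Real.exp (-a) * ∫ y, ψ y ≤ expAverage a ψ x := by
  have hcont : Continuous fun t : ℝ => ψ (x + t) :=
    ψ.continuous.comp (continuous_const.add (AddCircle.continuous_mk' 1))
  have hint : ∫ y, ψ y = ∫ t in (0 : ℝ)..1, ψ (x + t) := by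
    rw [← integral_add_left_eq_self ψ x, ← UnitAddCircle.intervalIntegral_preimage 0, zero_add]
  rw [hint, ← intervalIntegral.integral_const_mul]
  refine intervalIntegral.integral_mono_on zero_le_one
    ((hcont.const_mul _).intervalIntegrable _ _)
    (((by fun_prop : Continuous fun t : ℝ => Real.exp (-(a * t))).mul hcont).intervalIntegrable _ _)
    fun t ht => mul_le_mul_of_nonneg_right (Real.exp_le_exp.2 ?_) (hψ _)
  exact neg_le_neg (mul_le_of_le_one_right ha ht.2)

/- Test `f` against the derivative of `φ - m`, where `φ = expAverage a ψ` and `m` is its lower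
bound: since `φ - m ≥ 0`, the term `a ⟨f, φ⟩` cancels from the cone inequality. -/
theorem LogLipschitz.mul_integral_mul_le_pairing {f : CircleL1} (hf : LogLipschitz a f)
    (ha : 0 ≤ a) (hψ : 0 ≤ ψ) :
    a * Real.exp (-a) * (∫ x, ψ x) * pairing f 1 ≤ pairing f ψ := by
  set m := Real.exp (-a) * ∫ x, ψ x
  set φ := expAverage a ψ - ContinuousMap.const _ m with hφ
  have hderiv : IsCircleDeriv φ (a • expAverage a ψ - (1 - Real.exp (-a)) • ψ) := fun x =>
    (isCircleDeriv_expAverage a ψ x).sub_const m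
  have habs : |φ| = expAverage a ψ - m • (1 : C(UnitAddCircle, ℝ)) := by
    rw [abs_of_nonneg fun x => sub_nonneg.2 (exp_mul_integral_le_expAverage ha hψ x)]
    ext x
    simp [hφ]
  have hcone := (le_abs_self _).trans (hf.deriv_le _ _ hderiv)
  simp only [habs, map_sub, map_smul, smul_eq_mul] at hcone
  linarith [mul_nonneg (Real.exp_pos (-a)).le (pairing_nonneg hf.nonneg hψ)]

end Minorization

section PowerBounded

variable {E : Type*} [SeminormedAddCommGroup E] [NormedSpace ℝ E] {P : E →L[ℝ] E}

theorem norm_pow_apply_le (hP : ‖P‖ ≤ 1) (f : E) (n : ℕ) : ‖(P ^ n) f‖ ≤ ‖f‖ := by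
  induction n with
  | zero => rw [pow_zero, one_apply_eq_self]
  | succ n ih =>
    rw [pow_succ', mul_apply_eq_comp]
    exact (P.le_of_opNorm_le hP _).trans (by rwa [one_mul])

theorem pow_apply_eq_self {f : E} (hf : P f = f) (n : ℕ) : (P ^ n) f = f := by
  induction n with
  | zero => rw [pow_zero, one_apply_eq_self]
  | succ n ih => rw [pow_succ, mul_apply_eq_comp, hf, ih]

theorem norm_pow_apply_sub_self_le (hP : ‖P‖ ≤ 1) (f : E) (n : ℕ) :
    ‖(P ^ n) f - f‖ ≤ n * ‖P f - f‖ := by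
  induction n with
  | zero => simp
  | succ n ih =>
    calc ‖(P ^ (n + 1)) f - f‖ = ‖(P ^ n) (P f - f) + ((P ^ n) f - f)‖ := by
          rw [pow_succ, mul_apply_eq_comp, map_sub, sub_add_sub_cancel]
      _ ≤ ‖P f - f‖ + n * ‖P f - f‖ :=
          norm_add_le_of_le (norm_pow_apply_le hP _ n) ih
      _ = (n + 1 : ℕ) * ‖P f - f‖ := by push_cast; ring

theorem isClosed_setOf_tendsto_pow_apply_zero (hP : ‖P‖ ≤ 1) :
    IsClosed {f : E | Tendsto (fun n => (P ^ n) f) atTop (𝓝 0)} := by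
  refine (LipschitzWith.uniformEquicontinuous (fun n => ⇑(P ^ n)) 1 fun n =>
    ?_).equicontinuous.isClosed_setOfPred_tendsto continuous_const
  refine LipschitzWith.of_dist_le_mul fun f g => ?_
  rw [NNReal.coe_one, one_mul, dist_eq_norm, dist_eq_norm, ← map_sub]
  exact norm_pow_apply_le hP _ n

end PowerBounded

section ConeContraction

/-- The proportion of mass coupled with the uniform density when a `b`-log-Lipschitz density is
split off inside the cone of `a`-log-Lipschitz densities. The second factor is the minorization
constant; the first is the slack that keeps the remainder inside the larger cone. -/
def couplingRate (a b : ℝ) : ℝ :=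
  (1 - b / a) * (b * Real.exp (-b))

theorem mul_exp_neg_lt_one (t : ℝ) : t * Real.exp (-t) < 1 := by
  rw [Real.exp_neg, ← div_eq_mul_inv, div_lt_one (Real.exp_pos _)]
  linarith [Real.add_one_le_exp t]

variable {a b : ℝ}

theorem couplingRate_pos (hb : 0 < b) (hab : b < a) : 0 < couplingRate a b :=
  mul_pos (sub_pos.2 ((div_lt_one (hb.trans hab)).2 hab)) (mul_pos hb (Real.exp_pos _))

theorem couplingRate_le (hb : 0 < b) (hab : b < a) : couplingRate a b ≤ b * Real.exp (-b) :=
  mul_le_of_le_one_left (mul_pos hb (Real.exp_pos _)).le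
    (sub_le_self _ (div_pos hb (hb.trans hab)).le)

theorem couplingRate_lt_one (hb : 0 < b) (hab : b < a) : couplingRate a b < 1 :=
  (couplingRate_le hb hab).trans_lt (mul_exp_neg_lt_one b)

variable {f g : CircleL1}

theorem LogLipschitz.norm_sub_le (hf : LogLipschitz a f) (hg : LogLipschitz a g)
    (hfg : pairing f 1 = pairing g 1) : ‖f - g‖ ≤ 2 * pairing f 1 := by
  have htri := _root_.norm_sub_le f g
  rw [norm_eq_pairing_one hf.nonneg, norm_eq_pairing_one hg.nonneg, ← hfg] at htri
  linarith

theorem LogLipschitz.sub_couplingRate_smul (hf : LogLipschitz b f) (hb : 0 < b) (hab : b < a) :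
    LogLipschitz a (f - (couplingRate a b * pairing f 1) • uniformDensity) := by
  have ha := hb.trans hab
  have hmass : 0 ≤ pairing f 1 := pairing_nonneg hf.nonneg zero_le_one
  refine ⟨nonneg_iff_forall_pairing_nonneg.2 fun ψ hψ => ?_, fun φ φ' h => ?_⟩
  · have hmin := hf.mul_integral_mul_le_pairing hb.le hψ
    have hrate := mul_le_mul_of_nonneg_right (couplingRate_le hb hab)
      (mul_nonneg (integral_nonneg hψ : 0 ≤ ∫ x, ψ x) hmass)
    simp only [map_sub, map_smul, sub_apply, smul_apply, smul_eq_mul, pairing_uniformDensity]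
    linarith
  · have hmin := mul_le_mul_of_nonneg_left
      (hf.mul_integral_mul_le_pairing hb.le (abs_nonneg φ)) (sub_pos.2 hab).le
    have hslack : a * couplingRate a b = (a - b) * (b * Real.exp (-b)) := by
      rw [couplingRate]
      field_simp
    simp only [map_sub, map_smul, sub_apply, smul_apply, smul_eq_mul, pairing_uniformDensity,
      h.integral_eq_zero, mul_zero, sub_zero]
    linear_combination hf.deriv_le φ φ' h + hmin + pairing f 1 * (∫ x, (|φ|) x) * hslack

theorem LogLipschitz.exists_eq_coupling (hf : LogLipschitz b f) (hb : 0 < b) (hab : b < a) :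
    ∃ g, LogLipschitz a g ∧ pairing g 1 = pairing f 1 ∧
      f = (couplingRate a b * pairing f 1) • uniformDensity + (1 - couplingRate a b) • g := by
  have hκ : 0 < 1 - couplingRate a b := sub_pos.2 (couplingRate_lt_one hb hab)
  refine ⟨_, (hf.sub_couplingRate_smul hb hab).smul (inv_pos.2 hκ).le, ?_, ?_⟩
  · simp only [map_sub, map_smul, sub_apply, smul_apply, smul_eq_mul, pairing_uniformDensity_one]
    field_simp
  · rw [smul_inv_smul₀ hκ.ne', add_sub_cancel]

/-- `P` is a nonexpansive, mass-preserving operator which maps the cone of `a`-log-Lipschitz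
densities into the strictly smaller cone of `b`-log-Lipschitz densities. -/
structure ContractsCone (a b : ℝ) (P : CircleL1 →L[ℝ] CircleL1) : Prop where
  pos : 0 < b
  lt : b < a
  norm_le : ‖P‖ ≤ 1
  mass : ∀ f, pairing (P f) 1 = pairing f 1
  map : ∀ f, LogLipschitz a f → LogLipschitz b (P f)

namespace ContractsCone

variable {P : CircleL1 →L[ℝ] CircleL1}

theorem norm_pow_apply_sub_le (hP : ContractsCone a b P) (n : ℕ) {f g : CircleL1}
    (hf : LogLipschitz a f) (hg : LogLipschitz a g) (hfg : pairing f 1 = pairing g 1) :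
    ‖(P ^ n) (f - g)‖ ≤ 2 * pairing f 1 * (1 - couplingRate a b) ^ n := by
  induction n generalizing f g with
  | zero => simpa using hf.norm_sub_le hg hfg
  | succ n ih =>
    obtain ⟨f', hf', hmassf, hPf⟩ := (hP.map f hf).exists_eq_coupling hP.pos hP.lt
    obtain ⟨g', hg', hmassg, hPg⟩ := (hP.map g hg).exists_eq_coupling hP.pos hP.lt
    rw [hP.mass] at hmassf hmassg hPf hPg
    have hκ : 0 ≤ 1 - couplingRate a b := (sub_pos.2 (couplingRate_lt_one hP.pos hP.lt)).le
    have hcoupled : P (f - g) = (1 - couplingRate a b) • (f' - g') := by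
      rw [map_sub, hPf, hPg, hfg, add_sub_add_left_eq_sub, smul_sub]
    calc ‖(P ^ (n + 1)) (f - g)‖ = (1 - couplingRate a b) * ‖(P ^ n) (f' - g')‖ := by
          rw [pow_succ, mul_apply_eq_comp, hcoupled, map_smul, norm_smul, Real.norm_of_nonneg hκ]
      _ ≤ (1 - couplingRate a b) * (2 * pairing f' 1 * (1 - couplingRate a b) ^ n) :=
          mul_le_mul_of_nonneg_left (ih hf' hg' (by rw [hmassf, hmassg, hfg])) hκ
      _ = 2 * pairing f 1 * (1 - couplingRate a b) ^ (n + 1) := by rw [hmassf]; ring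

theorem tendsto_pow_apply_sub (hP : ContractsCone a b P) (hf : LogLipschitz a f)
    (hg : LogLipschitz a g) (hfg : pairing f 1 = pairing g 1) :
    Tendsto (fun n => (P ^ n) (f - g)) atTop (𝓝 0) := by
  refine squeeze_zero_norm (fun n => hP.norm_pow_apply_sub_le n hf hg hfg) ?_
  rw [← mul_zero (2 * pairing f 1)]
  exact (tendsto_pow_atTop_nhds_zero_of_lt_one
    (sub_pos.2 (couplingRate_lt_one hP.pos hP.lt)).le
    (sub_lt_self 1 (couplingRate_pos hP.pos hP.lt))).const_mul _

theorem logLipschitz_pow_apply (hP : ContractsCone a b P) (hf : LogLipschitz a f) (n : ℕ) :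
    LogLipschitz a ((P ^ n) f) := by
  induction n with
  | zero => simpa using hf
  | succ n ih =>
    rw [pow_succ', mul_apply_eq_comp]
    exact (hP.map _ ih).mono hP.lt.le

theorem pairing_pow_apply_one (hP : ContractsCone a b P) (f : CircleL1) (n : ℕ) :
    pairing ((P ^ n) f) 1 = pairing f 1 := by
  induction n with
  | zero => rw [pow_zero, one_apply_eq_self]
  | succ n ih => rw [pow_succ', mul_apply_eq_comp, hP.mass, ih]

theorem exists_fixed (hP : ContractsCone a b P) :
    ∃ h, LogLipschitz a h ∧ pairing h 1 = 1 ∧ P h = h := by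
  have hunif := logLipschitz_uniformDensity (hP.pos.trans hP.lt).le
  have hcauchy : CauchySeq fun n => (P ^ n) uniformDensity := by
    refine cauchySeq_of_le_geometric (1 - couplingRate a b) 2
      (sub_lt_self 1 (couplingRate_pos hP.pos hP.lt)) fun n => ?_
    rw [dist_eq_norm, pow_succ, mul_apply_eq_comp, ← map_sub]
    simpa only [pairing_uniformDensity_one, mul_one] using hP.norm_pow_apply_sub_le n hunif
      ((hP.map _ hunif).mono hP.lt.le) (hP.mass uniformDensity).symm
  obtain ⟨h, hh⟩ := cauchySeq_tendsto_of_complete hcauchy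
  refine ⟨h, .of_tendsto (hP.logLipschitz_pow_apply hunif) hh, ?_, ?_⟩
  · refine tendsto_nhds_unique (tendsto_pairing hh 1) ?_
    simp only [hP.pairing_pow_apply_one, pairing_uniformDensity_one, tendsto_const_nhds]
  · refine tendsto_nhds_unique ((P.continuous.tendsto h).comp hh) ?_
    simpa only [pow_succ', mul_apply_eq_comp, Function.comp_def]
      using (tendsto_add_atTop_iff_nat 1).2 hh

end ContractsCone

end ConeContraction

section Mixing

/-- The algebra of continuously differentiable functions on the circle. -/
def circleC1 : Subalgebra ℝ C(UnitAddCircle, ℝ) where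
  carrier := {φ | ∃ φ', IsCircleDeriv φ φ'}
  mul_mem' := fun ⟨_, h⟩ ⟨_, k⟩ => ⟨_, h.mul k⟩
  add_mem' := fun ⟨_, h⟩ ⟨_, k⟩ => ⟨_, h.add k⟩
  algebraMap_mem' := fun c => ⟨0, IsCircleDeriv.const c⟩

theorem comp_fourier_mem_circleC1 (ℓ : ℂ →L[ℝ] ℝ) (n : ℤ) :
    (⟨fun x => ℓ (fourier n x), by fun_prop⟩ : C(UnitAddCircle, ℝ)) ∈ circleC1 :=
  ⟨⟨fun x => ℓ (2 * Real.pi * Complex.I * n / (1 : ℝ) * fourier n x), by fun_prop⟩,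
    fun x => ℓ.hasFDerivAt.comp_hasDerivAt x (hasDerivAt_fourier 1 n x)⟩

theorem circleC1_separatesPoints : circleC1.SeparatesPoints := by
  intro x y hxy
  by_contra! hne
  refine hxy (AddCircle.injective_toCircle one_ne_zero (Subtype.ext ?_))
  have hre := hne _ ⟨_, comp_fourier_mem_circleC1 Complex.reCLM 1, rfl⟩
  have him := hne _ ⟨_, comp_fourier_mem_circleC1 Complex.imCLM 1, rfl⟩
  simpa only [fourier_one] using Complex.ext hre him

theorem dense_toLp_circleC1 :
    Dense (ContinuousMap.toLp 1 (volume : Measure UnitAddCircle) ℝ ''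
      (circleC1 : Set C(UnitAddCircle, ℝ))) := by
  refine (ContinuousMap.toLp_denseRange ℝ (volume : Measure UnitAddCircle) ℝ
    (p := 1) ENNReal.one_ne_top).dense_image (ContinuousMap.toLp 1 volume ℝ).continuous ?_
  rw [dense_iff_closure_eq, ← Subalgebra.topologicalClosure_coe,
    ContinuousMap.subalgebra_topologicalClosure_eq_top_of_separatesPoints _
      circleC1_separatesPoints, Algebra.coe_top]

variable {P : CircleL1 →L[ℝ] CircleL1}

/- A large constant is added to a `C¹` density to bring it into the cone; the constant cancels
against the corresponding multiple of the uniform density. -/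
theorem tendsto_pow_apply_sub_uniformDensity (hP : ∃ᶠ a in atTop, ∃ b, ContractsCone a b P)
    (f : CircleL1) :
    Tendsto (fun n => (P ^ n) (f - pairing f 1 • uniformDensity)) atTop (𝓝 0) := by
  have hnorm : ‖P‖ ≤ 1 := let ⟨_, _, h⟩ := hP.exists; h.norm_le
  have hcont : Continuous fun f : CircleL1 => f - pairing f 1 • uniformDensity := by fun_prop
  refine dense_toLp_circleC1.induction (P := fun f : CircleL1 =>
    Tendsto (fun n => (P ^ n) (f - pairing f 1 • uniformDensity)) atTop (𝓝 0)) ?_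
    ((isClosed_setOf_tendsto_pow_apply_zero hnorm).preimage hcont) f
  rintro _ ⟨φ, ⟨φ', hφ⟩, rfl⟩
  obtain ⟨a, ha, b, hcontr⟩ := hP.forall_exists_of_atTop ‖φ'‖
  set M := ‖φ‖ + 1
  set ψ := φ + ContinuousMap.const _ M with hψ
  have hψ_one : 1 ≤ ψ := fun x => by
    have hφx := neg_le_of_abs_le (φ.norm_coe_le_norm x)
    change 1 ≤ φ x + (‖φ‖ + 1)
    linarith
  have hψ_toLp : ContinuousMap.toLp 1 volume ℝ ψ =
      ContinuousMap.toLp 1 volume ℝ φ + M • uniformDensity := by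
    rw [hψ, map_add, uniformDensity, ← map_smul]
    congr 2
    ext x
    simp
  have hψ_cone : LogLipschitz a (ContinuousMap.toLp 1 volume ℝ ψ) :=
    (hφ.add (.const M)).logLipschitz_toLp (zero_le_one.trans hψ_one) fun x => by
      rw [add_zero]
      exact ((φ'.norm_coe_le_norm x).trans ha).trans
        (le_mul_of_one_le_right ((norm_nonneg _).trans ha) (hψ_one x))
  have hmass : 0 ≤ pairing (ContinuousMap.toLp 1 volume ℝ ψ) 1 :=
    pairing_nonneg hψ_cone.nonneg zero_le_one
  refine (hcontr.tendsto_pow_apply_sub hψ_cone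
    ((logLipschitz_uniformDensity (hcontr.pos.trans hcontr.lt).le).smul hmass) ?_).congr
    fun n => congrArg (P ^ n) ?_
  · rw [map_smul, smul_apply, pairing_uniformDensity_one, smul_eq_mul, mul_one]
  · simp only [hψ_toLp, map_add, map_smul, add_apply, smul_apply, smul_eq_mul,
      pairing_uniformDensity_one, mul_one, add_smul, add_sub_add_right_eq_sub]

theorem eq_of_fixed_of_pairing_one_eq (hP : ∃ᶠ a in atTop, ∃ b, ContractsCone a b P)
    {f g : CircleL1} (hf : P f = f) (hg : P g = g) (hfg : pairing f 1 = pairing g 1) : f = g := by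
  have hlim := (tendsto_pow_apply_sub_uniformDensity hP f).sub
    (tendsto_pow_apply_sub_uniformDensity hP g)
  simp only [← map_sub, hfg, sub_sub_sub_cancel_right] at hlim
  simp only [map_sub, pow_apply_eq_self hf, pow_apply_eq_self hg, sub_zero] at hlim
  exact sub_eq_zero.1 (tendsto_nhds_unique tendsto_const_nhds hlim)

end Mixing

theorem exists_int_forall_abs_sub_le {X : Type*} [TopologicalSpace X] [PreconnectedSpace X]
    [Nonempty X] {e : X → ℝ} (he : Continuous e) {c : ℝ} (hc : c < 1 / 2)
    (h : ∀ x, ∃ n : ℤ, |e x - n| ≤ c) : ∃ n : ℤ, ∀ x, |e x - n| ≤ c := by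
  have hround : ∀ x, |e x - round (e x)| ≤ c := fun x =>
    let ⟨n, hn⟩ := h x
    (round_le (e x) n).trans hn
  have hlocal : IsLocallyConstant fun x => round (e x) := by
    refine (IsLocallyConstant.iff_eventually_eq _).2 fun x => ?_
    filter_upwards [Metric.tendsto_nhds.1 (he.tendsto x) (1 - 2 * c) (by linarith)] with y hy
    have hx := abs_le.1 (hround x)
    have hy' := abs_le.1 (hround y)
    rw [Real.dist_eq, abs_lt] at hy
    refine sub_eq_zero.1 (Int.abs_lt_one_iff.1 ?_)
    have hlt : |((round (e y) - round (e x) : ℤ) : ℝ)| < 1 := by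
      push_cast
      exact abs_lt.2 ⟨by linarith, by linarith⟩
    exact_mod_cast hlt
  obtain ⟨x₀⟩ := ‹Nonempty X›
  exact ⟨round (e x₀), fun x => hlocal.apply_eq_of_preconnectedSpace x x₀ ▸ hround x⟩

namespace ExpandingCircleMap

section Derivatives

variable (T : ExpandingCircleMap)

theorem exists_degree : ∃ d : ℤ, ∀ x, T.lift (x + 1) = T.lift x + d := by
  have hcont := T.contDiff_lift.continuous
  obtain ⟨d, hd⟩ := exists_int_forall_abs_sub_le (e := fun x => T.lift (x + 1) - T.lift x)
    (by fun_prop) (c := 0) one_half_pos fun x => by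
      have hcoe : ((T.lift (x + 1) - T.lift x : ℝ) : UnitAddCircle) = 0 := by
        rw [AddCircle.coe_sub, ← T.coe_lift, ← T.coe_lift, AddCircle.coe_add_period, sub_self]
      obtain ⟨n, hn⟩ := (AddCircle.coe_eq_zero_iff 1).1 hcoe
      exact ⟨n, by simp [← hn]⟩
  exact ⟨d, fun x => by linarith [abs_nonpos_iff.1 (hd x)]⟩

theorem periodic_deriv_lift : Function.Periodic (deriv T.lift) 1 := fun x => by
  obtain ⟨d, hd⟩ := T.exists_degree
  rw [← deriv_comp_add_const, funext hd, deriv_add_const]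

theorem periodic_deriv_deriv_lift : Function.Periodic (deriv (deriv T.lift)) 1 := fun x => by
  rw [← deriv_comp_add_const, funext T.periodic_deriv_lift]

/-- The derivative `T'` as a function on the circle. -/
def circleDeriv : C(UnitAddCircle, ℝ) :=
  circleMapOfPeriodic T.periodic_deriv_lift T.contDiff_deriv_lift.continuous

/-- The second derivative `T''` as a function on the circle. -/
def circleDeriv₂ : C(UnitAddCircle, ℝ) :=
  circleMapOfPeriodic T.periodic_deriv_deriv_lift T.continuous_deriv_deriv_lift

theorem one_lt_abs_circleDeriv (x : UnitAddCircle) : 1 < |T.circleDeriv x| :=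
  forall_unitAddCircle_iff (p := fun x => 1 < |T.circleDeriv x|).2 T.expanding x

theorem circleDeriv_ne_zero (x : UnitAddCircle) : T.circleDeriv x ≠ 0 :=
  abs_pos.1 (zero_lt_one.trans (T.one_lt_abs_circleDeriv x))

/-- The reciprocal `1 / T'` of the derivative, as a function on the circle. -/
def invDeriv : C(UnitAddCircle, ℝ) :=
  ⟨fun x => (T.circleDeriv x)⁻¹, T.circleDeriv.continuous.inv₀ T.circleDeriv_ne_zero⟩

/-- The distortion `(1 / T')' = -T'' / T'²`, as a function on the circle. -/
def distortion : C(UnitAddCircle, ℝ) :=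
  ⟨fun x => -T.circleDeriv₂ x / T.circleDeriv x ^ 2,
    T.circleDeriv₂.continuous.neg.div (T.circleDeriv.continuous.pow 2)
      fun x => pow_ne_zero 2 (T.circleDeriv_ne_zero x)⟩

theorem circleDeriv_mul_invDeriv : T.circleDeriv * T.invDeriv = 1 := by
  ext x
  exact mul_inv_cancel₀ (T.circleDeriv_ne_zero x)

theorem isCircleDeriv_invDeriv : IsCircleDeriv T.invDeriv T.distortion := fun x =>
  (T.hasDerivAt_deriv_lift x).inv (T.deriv_lift_ne_zero x)

theorem isCircleDeriv_koopman {φ φ' : C(UnitAddCircle, ℝ)} (h : IsCircleDeriv φ φ') :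
    IsCircleDeriv (T.koopman φ) (T.koopman φ' * T.circleDeriv) := fun x => by
  have hcomp := (h (T.lift x)).comp x (T.hasDerivAt_lift x)
  simp only [Function.comp_def, ← T.coe_lift] at hcomp
  exact hcomp

theorem isCircleDeriv_koopman_mul_invDeriv {φ φ' : C(UnitAddCircle, ℝ)}
    (h : IsCircleDeriv φ φ') :
    IsCircleDeriv (T.koopman φ * T.invDeriv) (T.koopman φ' + T.koopman φ * T.distortion) := by
  simpa only [mul_assoc, circleDeriv_mul_invDeriv, mul_one]
    using (T.isCircleDeriv_koopman h).mul T.isCircleDeriv_invDeriv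

/-- `T` expands by a factor of at least `lam > 1`, and its second derivative is bounded by `B`. -/
structure HasBounds (lam B : ℝ) : Prop where
  one_lt : 1 < lam
  le_deriv : ∀ x, lam ≤ |deriv T.lift x|
  deriv₂_le : ∀ x, |deriv (deriv T.lift) x| ≤ B

theorem exists_hasBounds : ∃ lam B, T.HasBounds lam B := by
  obtain ⟨x₀, -, hx₀⟩ := isCompact_univ.exists_isMinOn (Set.univ_nonempty (α := UnitAddCircle))
    T.circleDeriv.continuous.abs.continuousOn
  exact ⟨|T.circleDeriv x₀|, ‖T.circleDeriv₂‖, T.one_lt_abs_circleDeriv x₀,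
    fun x => hx₀ (Set.mem_univ (x : UnitAddCircle)), fun x => T.circleDeriv₂.norm_coe_le_norm x⟩

end Derivatives

theorem eventually_div_add_lt {lam : ℝ} (hlam : 1 < lam) (B : ℝ) :
    ∀ᶠ a in atTop, a / lam + B < a := by
  have hgap : 0 < 1 - lam⁻¹ := sub_pos.2 (inv_lt_one_of_one_lt₀ hlam)
  filter_upwards [(tendsto_id.atTop_mul_const hgap).eventually_gt_atTop B] with a ha
  rw [div_eq_mul_inv]
  linarith [show B < a * (1 - lam⁻¹) from ha]

namespace HasBounds

variable {T : ExpandingCircleMap} {lam B a : ℝ} (hT : T.HasBounds lam B)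
include hT

theorem nonneg : 0 ≤ B := (abs_nonneg _).trans (hT.deriv₂_le 0)

theorem abs_invDeriv_le (x : UnitAddCircle) : |T.invDeriv x| ≤ lam⁻¹ := by
  refine forall_unitAddCircle_iff (p := fun x => |T.invDeriv x| ≤ lam⁻¹).2 (fun x => ?_) x
  change |(deriv T.lift x)⁻¹| ≤ lam⁻¹
  rw [abs_inv]
  exact inv_anti₀ (zero_lt_one.trans hT.one_lt) (hT.le_deriv x)

theorem abs_distortion_le (x : UnitAddCircle) : |T.distortion x| ≤ B := by
  refine forall_unitAddCircle_iff (p := fun x => |T.distortion x| ≤ B).2 (fun x => ?_) x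
  change |-deriv (deriv T.lift) x / deriv T.lift x ^ 2| ≤ B
  rw [abs_div, abs_neg, abs_pow]
  exact (div_le_self (abs_nonneg _) (one_le_pow₀ (T.expanding x).le)).trans (hT.deriv₂_le x)

theorem logLipschitz_transfer (ha : 0 ≤ a) {f : CircleL1} (hf : LogLipschitz a f) :
    LogLipschitz (a / lam + B) (T.transfer f) where
  nonneg := nonneg_iff_forall_pairing_nonneg.2 fun ψ hψ => by
    rw [T.pairing_transfer]
    exact pairing_nonneg hf.nonneg fun x => hψ (T x)
  deriv_le φ φ' h := by
    have hcone := hf.deriv_le _ _ (T.isCircleDeriv_koopman_mul_invDeriv h)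
    have hcontr : pairing f |T.koopman φ * T.invDeriv| ≤ pairing f (lam⁻¹ • T.koopman |φ|) := by
      refine pairing_mono hf.nonneg fun x => ?_
      change |φ (T x) * T.invDeriv x| ≤ lam⁻¹ * |φ (T x)|
      rw [abs_mul, mul_comm]
      exact mul_le_mul_of_nonneg_right (hT.abs_invDeriv_le x) (abs_nonneg _)
    have hdist : |pairing f (T.koopman φ * T.distortion)| ≤ pairing f (B • T.koopman |φ|) := by
      refine abs_pairing_le_pairing hf.nonneg fun x => ?_
      change |φ (T x) * T.distortion x| ≤ B * |φ (T x)|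
      rw [abs_mul, mul_comm]
      exact mul_le_mul_of_nonneg_right (hT.abs_distortion_le x) (abs_nonneg _)
    rw [map_smul, smul_eq_mul] at hcontr hdist
    rw [T.pairing_transfer, T.pairing_transfer, ← add_sub_cancel_right (T.koopman φ')
      (T.koopman φ * T.distortion), map_sub]
    calc _ ≤ a * pairing f |T.koopman φ * T.invDeriv| +
          |pairing f (T.koopman φ * T.distortion)| :=
          (abs_sub _ _).trans (add_le_add_left hcone _)
      _ ≤ a * (lam⁻¹ * pairing f (T.koopman |φ|)) + B * pairing f (T.koopman |φ|) :=
          add_le_add (mul_le_mul_of_nonneg_left hcontr ha) hdist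
      _ = (a / lam + B) * pairing f (T.koopman |φ|) := by ring

theorem contractsCone (ha : a / lam + B < a) : ContractsCone a (a / lam + B) T.transfer := by
  have ha_pos : 0 < a := by
    by_contra! hneg
    have hself : a ≤ a / lam := by
      rw [le_div_iff₀ (zero_lt_one.trans hT.one_lt)]
      nlinarith [hT.one_lt]
    linarith [hT.nonneg]
  exact {
    pos := add_pos_of_pos_of_nonneg (div_pos ha_pos (zero_lt_one.trans hT.one_lt)) hT.nonneg
    lt := ha
    norm_le := T.norm_transfer_le
    mass := fun f => by rw [T.pairing_transfer, T.koopman_one]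
    map := fun f => hT.logLipschitz_transfer ha_pos.le }

end HasBounds

theorem eventually_contractsCone_transfer (T : ExpandingCircleMap) :
    ∀ᶠ a in atTop, ∃ b, ContractsCone a b T.transfer := by
  obtain ⟨lam, B, hT⟩ := T.exists_hasBounds
  exact (eventually_div_add_lt hT.one_lt B).mono fun a ha => ⟨_, hT.contractsCone ha⟩

theorem exists_unique_isInvariantDensity (T : ExpandingCircleMap) :
    ∃ h : UnitAddCircle → ℝ, IsInvariantDensity T h ∧
      ∀ g : UnitAddCircle → ℝ, IsInvariantDensity T g → g =ᵐ[volume] h := by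
  have hcontr := T.eventually_contractsCone_transfer
  obtain ⟨a, b, hab⟩ := hcontr.exists
  obtain ⟨h, hcone, hmass, hfix⟩ := hab.exists_fixed
  refine ⟨h, (T.isInvariantDensity_iff (L1.integrable_coeFn h)).2 ?_, fun g hg => ?_⟩
  · rw [Integrable.toL1_coeFn]
    exact ⟨hcone.nonneg, hmass, hfix⟩
  · obtain ⟨-, hmass', hfix'⟩ := (T.isInvariantDensity_iff hg.1).1 hg
    rw [← eq_of_fixed_of_pairing_one_eq hcontr.frequently hfix' hfix (hmass'.trans hmass.symm)]
    exact hg.1.coeFn_toL1.symm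

end ExpandingCircleMap

theorem intervalIntegral_add_intCast (ψ : C(UnitAddCircle, ℝ)) (a b : ℝ) (d : ℤ) :
    ∫ y in a + d..b + d, ψ (y : UnitAddCircle) = ∫ y in a..b, ψ (y : UnitAddCircle) := by
  rw [← intervalIntegral.integral_comp_add_right fun y : ℝ => ψ (y : UnitAddCircle)]
  have hd : ((d : ℝ) : UnitAddCircle) = 0 := (AddCircle.coe_eq_zero_iff 1).2 ⟨d, by simp⟩
  simp only [AddCircle.coe_add, hd, add_zero]

namespace ExpandingCircleMap

section Perturbation

variable {T S : ExpandingCircleMap} {ε : ℝ}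

theorem exists_int_lift_sub_lift_le (hε : ε < 1 / 2) (h₀ : ∀ x, ‖T x - S x‖ ≤ ε) :
    ∃ n : ℤ, ∀ x, |T.lift x - S.lift x - n| ≤ ε := by
  have hT := T.contDiff_lift.continuous
  have hS := S.contDiff_lift.continuous
  refine exists_int_forall_abs_sub_le (hT.sub hS) hε fun x => ?_
  have hx := h₀ x
  rw [T.coe_lift, S.coe_lift, ← AddCircle.coe_sub, UnitAddCircle.norm_eq] at hx
  exact ⟨_, hx⟩

theorem degree_eq_of_lift_sub_lift_le (hε : ε < 1 / 2) {n : ℤ}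
    (hn : ∀ x, |T.lift x - S.lift x - n| ≤ ε) {d e : ℤ}
    (hd : ∀ x, T.lift (x + 1) = T.lift x + d) (he : ∀ x, S.lift (x + 1) = S.lift x + e) :
    d = e := by
  have hstart := abs_le.1 (hn 0)
  have hend := abs_le.1 (hn (0 + 1))
  rw [hd, he] at hend
  have hlt : |((d - e : ℤ) : ℝ)| < 1 := by
    push_cast
    exact abs_lt.2 ⟨by linarith, by linarith⟩
  exact sub_eq_zero.1 (Int.abs_lt_one_iff.1 (by exact_mod_cast hlt))

theorem hasDerivAt_integral_lift (T : ExpandingCircleMap) (ψ : C(UnitAddCircle, ℝ)) (x : ℝ) :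
    HasDerivAt (fun x => ∫ y in (0 : ℝ)..T.lift x, ψ (y : UnitAddCircle))
      ((T.koopman ψ * T.circleDeriv) (x : UnitAddCircle)) x := by
  have hprim := ((continuous_comp_coe ψ).integral_hasStrictDerivAt 0 (T.lift x)).hasDerivAt
  have hcomp := hprim.comp x (T.hasDerivAt_lift x)
  rwa [← T.coe_lift] at hcomp

theorem exists_isCircleDeriv_koopman_sub (hε : ε < 1 / 2) (h₀ : ∀ x, ‖T x - S x‖ ≤ ε)
    {ψ : C(UnitAddCircle, ℝ)} (hψ : ∀ x, |ψ x| ≤ 1) :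
    ∃ H, IsCircleDeriv H (T.koopman ψ * T.circleDeriv - S.koopman ψ * S.circleDeriv) ∧
      ∀ x, |H x| ≤ ε := by
  obtain ⟨n, hn⟩ := exists_int_lift_sub_lift_le hε h₀
  obtain ⟨d, hd⟩ := T.exists_degree
  obtain ⟨e, he⟩ := S.exists_degree
  obtain rfl := degree_eq_of_lift_sub_lift_le hε hn hd he
  -- `H` integrates `ψ` along the short arc from `S x` to `T x`.
  set G : ℝ → ℝ := fun x => ∫ y in S.lift x + n..T.lift x, ψ (y : UnitAddCircle) with hG
  have hper : Function.Periodic G 1 := fun x => by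
    simp only [hG, hd, he, add_right_comm _ (d : ℝ), intervalIntegral_add_intCast]
  have hsplit : ∀ x, G x = (∫ y in (0 : ℝ)..T.lift x, ψ (y : UnitAddCircle)) -
      (∫ y in (0 : ℝ)..S.lift x, ψ (y : UnitAddCircle)) -
      ∫ y in (0 : ℝ)..n, ψ (y : UnitAddCircle) := fun x => by
    have hint := fun a b => (continuous_comp_coe ψ).intervalIntegrable (μ := volume) a b
    rw [← intervalIntegral_add_intCast ψ 0 (S.lift x) n, zero_add, sub_sub,
      add_comm (∫ y in (n : ℝ)..S.lift x + n, ψ (y : UnitAddCircle)),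
      intervalIntegral.integral_add_adjacent_intervals (hint _ _) (hint _ _),
      intervalIntegral.integral_interval_sub_left (hint _ _) (hint _ _)]
  have hderiv : ∀ x : ℝ, HasDerivAt G ((T.koopman ψ * T.circleDeriv
      - S.koopman ψ * S.circleDeriv) (x : UnitAddCircle)) x := fun x => by
    rw [funext hsplit]
    exact ((T.hasDerivAt_integral_lift ψ x).sub (S.hasDerivAt_integral_lift ψ x)).sub_const _
  refine ⟨circleMapOfPeriodic hper (continuous_iff_continuousAt.2 fun x =>
    (hderiv x).continuousAt), hderiv, forall_unitAddCircle_iff.2 fun x => ?_⟩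
  calc ‖G x‖ ≤ 1 * |T.lift x - (S.lift x + n)| :=
        intervalIntegral.norm_integral_le_of_norm_le_const fun y _ => hψ y
    _ ≤ ε := by
        rw [one_mul, ← sub_sub]
        exact hn x

namespace HasBounds

variable {lam B V : ℝ} {f : CircleL1}

theorem abs_invDeriv_le_one (hS : S.HasBounds lam B) (x : UnitAddCircle) : |S.invDeriv x| ≤ 1 :=
  (hS.abs_invDeriv_le x).trans (inv_le_one_of_one_le₀ hS.one_lt.le)

/- With `H` the primitive of `(ψ ∘ T) T' - (ψ ∘ S) S'`, the product `H / S'` has derivative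
`ψ ∘ T - ψ ∘ S` up to an error of order `ε`, so that the pairing of `f` with `ψ ∘ T - ψ ∘ S` is
controlled by the variation of `f`. -/
theorem norm_transfer_sub_le_of_lt (hS : S.HasBounds lam B) (hε : ε < 1 / 2)
    (h₀ : ∀ x, ‖T x - S x‖ ≤ ε) (h₁ : ∀ x, |deriv T.lift x - deriv S.lift x| ≤ ε)
    (hV : HasVariationLE V f) :
    ‖T.transfer f - S.transfer f‖ ≤ ε * ((1 + B) * ‖f‖ + V) := by
  have hε₀ : 0 ≤ ε := (norm_nonneg _).trans (h₀ 0)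
  refine norm_le_of_forall_pairing_le fun ψ hψ => ?_
  obtain ⟨H, hH, hHε⟩ := exists_isCircleDeriv_koopman_sub hε h₀ hψ
  have hderiv := hH.mul S.isCircleDeriv_invDeriv
  set g := (T.koopman ψ * T.circleDeriv - S.koopman ψ * S.circleDeriv) * S.invDeriv
    + H * S.distortion with hg
  have hmain : pairing f g ≤ V * ε := by
    refine (le_abs_self _).trans ((hV _ _ hderiv).trans (mul_le_mul_of_nonneg_left ?_ hV.nonneg))
    refine (ContinuousMap.norm_le _ hε₀).2 fun x => ?_
    rw [ContinuousMap.mul_apply, norm_mul]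
    exact (mul_le_of_le_one_right (norm_nonneg _) (hS.abs_invDeriv_le_one x)).trans (hHε x)
  have herror : pairing f (T.koopman ψ - S.koopman ψ - g) ≤ ε * (1 + B) * ‖f‖ := by
    refine (le_abs_self _).trans (abs_pairing_le_of_abs_le f fun x => ?_)
    have hx : S.circleDeriv x * S.invDeriv x = 1 := mul_inv_cancel₀ (S.circleDeriv_ne_zero x)
    have hsplit : (T.koopman ψ - S.koopman ψ - g) x
        = ψ (T x) * ((S.circleDeriv x - T.circleDeriv x) * S.invDeriv x)
          - H x * S.distortion x := by
      simp only [hg, ContinuousMap.sub_apply, ContinuousMap.add_apply, ContinuousMap.mul_apply,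
        koopman_apply]
      linear_combination (ψ (S x) - ψ (T x)) * hx
    have hdiff : |S.circleDeriv x - T.circleDeriv x| ≤ ε := by
      rw [abs_sub_comm]
      exact forall_unitAddCircle_iff (p := fun x => |T.circleDeriv x - S.circleDeriv x| ≤ ε).2 h₁ x
    calc |(T.koopman ψ - S.koopman ψ - g) x|
        ≤ |ψ (T x)| * (|S.circleDeriv x - T.circleDeriv x| * |S.invDeriv x|) +
            |H x| * |S.distortion x| := by
          rw [hsplit, ← abs_mul, ← abs_mul, ← abs_mul]
          exact abs_sub _ _
      _ ≤ 1 * (ε * 1) + ε * B := by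
          gcongr
          exacts [hψ _, hS.abs_invDeriv_le_one x, hHε x, hS.abs_distortion_le x]
      _ = ε * (1 + B) := by ring
  rw [map_sub, sub_apply, pairing_transfer, pairing_transfer]
  simp only [map_sub] at herror
  linarith

theorem norm_transfer_sub_le (hS : S.HasBounds lam B) (h₀ : ∀ x, ‖T x - S x‖ ≤ ε)
    (h₁ : ∀ x, |deriv T.lift x - deriv S.lift x| ≤ ε) (hV : HasVariationLE V f) :
    ‖T.transfer f - S.transfer f‖ ≤ ε * ((4 + B) * ‖f‖ + V) := by
  have hε₀ : 0 ≤ ε := (norm_nonneg _).trans (h₀ 0)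
  have hBf : 0 ≤ B * ‖f‖ := mul_nonneg hS.nonneg (norm_nonneg f)
  rcases lt_or_ge ε (1 / 2) with hε | hε
  · refine (hS.norm_transfer_sub_le_of_lt hε h₀ h₁ hV).trans (mul_le_mul_of_nonneg_left ?_ hε₀)
    linarith [norm_nonneg f]
  · have hT := T.transfer.le_of_opNorm_le T.norm_transfer_le f
    have hS' := S.transfer.le_of_opNorm_le S.norm_transfer_le f
    calc ‖T.transfer f - S.transfer f‖ ≤ 2 * ‖f‖ := by
          linarith [norm_sub_le (T.transfer f) (S.transfer f)]
      _ ≤ ε * (4 * ‖f‖) := by nlinarith [norm_nonneg f]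
      _ ≤ ε * ((4 + B) * ‖f‖ + V) :=
        mul_le_mul_of_nonneg_left (by linarith [hV.nonneg]) hε₀

theorem of_near (hS : S.HasBounds lam B) (h₁ : ∀ x, |deriv T.lift x - deriv S.lift x| ≤ ε)
    (h₂ : ∀ x, |deriv (deriv T.lift) x - deriv (deriv S.lift) x| ≤ ε) (hε : ε < lam - 1) :
    T.HasBounds (lam - ε) (B + ε) where
  one_lt := by linarith
  le_deriv x := by
    have hle := abs_sub_abs_le_abs_sub (deriv S.lift x) (deriv T.lift x)
    rw [abs_sub_comm] at hle
    linarith [hS.le_deriv x, h₁ x]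
  deriv₂_le x := by
    linarith [hS.deriv₂_le x, h₂ x,
      abs_sub_abs_le_abs_sub (deriv (deriv T.lift) x) (deriv (deriv S.lift) x)]

end HasBounds

end Perturbation

end ExpandingCircleMap

namespace HasW11Deriv

variable {f f' : UnitAddCircle → ℝ} (hf : HasW11Deriv f f')
include hf

theorem intervalIntegrable :
    IntervalIntegrable (fun t : ℝ => f' (t : UnitAddCircle)) volume 0 1 := by
  rw [intervalIntegrable_iff_integrableOn_Ioc_of_le zero_le_one]
  have hcomp := (UnitAddCircle.measurePreserving_mk 0).integrable_comp_of_integrable hf.1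
  rwa [zero_add] at hcomp

theorem absolutelyContinuousOnInterval :
    AbsolutelyContinuousOnInterval (fun x : ℝ => f (x : UnitAddCircle)) 0 1 := by
  have hconst : AbsolutelyContinuousOnInterval (fun _ : ℝ => f 0) 0 1 :=
    (contDiff_const (n := 1)).contDiffOn.absolutelyContinuousOnInterval
  rw [funext hf.2]
  exact hconst.add
    (hf.intervalIntegrable.absolutelyContinuousOnInterval_intervalIntegral Set.left_mem_uIcc)

theorem continuous : Continuous f := by
  have hper : Function.Periodic (fun t : ℝ => f' (t : UnitAddCircle)) 1 := fun t => by
    simp only [AddCircle.coe_add_period]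
  refine (QuotientAddGroup.isQuotientMap_mk (N := AddSubgroup.zmultiples (1 : ℝ))).continuous_iff.2
    ?_
  change Continuous fun x : ℝ => f (x : UnitAddCircle)
  rw [funext hf.2]
  exact continuous_const.add (intervalIntegral.continuous_primitive
    (fun _ _ => hper.intervalIntegrable₀ one_ne_zero hf.intervalIntegrable _ _) 0)

theorem integrable : Integrable f volume := integrable_continuousMap ⟨f, hf.continuous⟩

theorem ae_deriv_eq :
    ∀ᵐ x : ℝ, x ∈ Set.uIcc (0 : ℝ) 1 →
      deriv (fun x : ℝ => f (x : UnitAddCircle)) x = f' (x : UnitAddCircle) := by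
  filter_upwards [hf.intervalIntegrable.ae_hasDerivAt_integral] with x hx hmem
  rw [funext hf.2]
  exact ((hx hmem 0 Set.left_mem_uIcc).const_add (f 0)).deriv

theorem integral_mul_deriv_eq_neg {φ φ' : C(UnitAddCircle, ℝ)} (hφ : IsCircleDeriv φ φ') :
    ∫ x, f x * φ' x = -∫ x, f' x * φ x := by
  have hderiv : deriv (fun y : ℝ => φ (y : UnitAddCircle)) = fun y : ℝ => φ' y :=
    funext fun x => (hφ x).deriv
  have hC1 : ContDiff ℝ 1 fun y : ℝ => φ (y : UnitAddCircle) :=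
    contDiff_one_iff_deriv.2 ⟨fun x => (hφ x).differentiableAt, hderiv ▸ continuous_comp_coe φ'⟩
  have hparts := hf.absolutelyContinuousOnInterval.integral_mul_deriv_eq_deriv_mul
    (hC1.contDiffOn.absolutelyContinuousOnInterval (a := 0) (b := 1))
  have hae : ∫ x in (0 : ℝ)..1, deriv (fun x : ℝ => f (x : UnitAddCircle)) x * φ x
      = ∫ x in (0 : ℝ)..1, f' (x : UnitAddCircle) * φ x := by
    refine intervalIntegral.integral_congr_ae ?_
    filter_upwards [hf.ae_deriv_eq] with x hx hmem
    rw [hx (Set.uIoc_subset_uIcc hmem)]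
  have hends : ((1 : ℝ) : UnitAddCircle) = (0 : ℝ) := by simp
  have hf_int := UnitAddCircle.intervalIntegral_preimage 0 fun x => f x * φ' x
  have hf'_int := UnitAddCircle.intervalIntegral_preimage 0 fun x => f' x * φ x
  rw [zero_add] at hf_int hf'_int
  rw [← hf_int, ← hf'_int, ← hae]
  simpa only [hderiv, hends, sub_self, zero_sub] using hparts

theorem hasVariationLE : HasVariationLE (l1Norm f') (hf.integrable.toL1 f) := by
  intro φ φ' hφ
  rw [pairing_toL1, hf.integral_mul_deriv_eq_neg hφ, abs_neg, ← pairing_toL1 hf.1, mul_comm,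
    ← norm_toL1_eq_l1Norm hf.1]
  exact abs_pairing_le_of_abs_le _ φ.norm_coe_le_norm

end HasW11Deriv

section C2Dist

variable {T S : ExpandingCircleMap} {ε : ℝ}

theorem norm_le_of_iSup_enorm_le {ι E : Type*} [SeminormedAddCommGroup E] {f : ι → E}
    (hε : 0 ≤ ε) (h : ⨆ i, ‖f i‖ₑ ≤ ENNReal.ofReal ε) (i : ι) : ‖f i‖ ≤ ε := by
  rw [← ENNReal.ofReal_le_ofReal_iff hε, ofReal_norm]
  exact (le_iSup (fun i => ‖f i‖ₑ) i).trans h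

theorem norm_sub_le_of_c2Dist_le (hε : 0 ≤ ε) (h : c2Dist T S ≤ ENNReal.ofReal ε)
    (x : UnitAddCircle) : ‖T x - S x‖ ≤ ε :=
  norm_le_of_iSup_enorm_le (f := fun x => T x - S x) hε
    (((le_add_right le_rfl).trans (le_add_right le_rfl)).trans h) x

theorem abs_deriv_lift_sub_le_of_c2Dist_le (hε : 0 ≤ ε) (h : c2Dist T S ≤ ENNReal.ofReal ε)
    (x : ℝ) : |deriv T.lift x - deriv S.lift x| ≤ ε :=
  norm_le_of_iSup_enorm_le (f := fun x => deriv T.lift x - deriv S.lift x) hε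
    (((le_add_left le_rfl).trans (le_add_right le_rfl)).trans h) x

theorem abs_deriv_deriv_lift_sub_le_of_c2Dist_le (hε : 0 ≤ ε)
    (h : c2Dist T S ≤ ENNReal.ofReal ε) (x : ℝ) :
    |deriv (deriv T.lift) x - deriv (deriv S.lift) x| ≤ ε :=
  norm_le_of_iSup_enorm_le (f := fun x => deriv (deriv T.lift) x - deriv (deriv S.lift) x) hε
    ((le_add_left le_rfl).trans h) x

end C2Dist

section Stability

theorem ContractsCone.norm_sub_fixed_le {a b : ℝ} {P : CircleL1 →L[ℝ] CircleL1}
    (hP : ContractsCone a b P) {f g : CircleL1} (hf : LogLipschitz a f) (hg : LogLipschitz a g)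
    (hfg : pairing f 1 = pairing g 1) (hfix : P g = g) (n : ℕ) :
    ‖f - g‖ ≤ 2 * pairing f 1 * (1 - couplingRate a b) ^ n + n * ‖P f - f‖ := by
  have hsplit : f - g = (P ^ n) (f - g) - ((P ^ n) f - f) := by
    rw [map_sub, pow_apply_eq_self hfix]
    abel
  rw [hsplit]
  exact (norm_sub_le _ _).trans (add_le_add (hP.norm_pow_apply_sub_le n hf hg hfg)
    (norm_pow_apply_sub_self_le hP.norm_le f n))

namespace ExpandingCircleMap.HasBounds

variable {T S : ExpandingCircleMap} {lam B a : ℝ}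

theorem logLipschitz_of_isInvariantDensity (hT : T.HasBounds lam B) (ha : a / lam + B < a)
    {h : UnitAddCircle → ℝ} (hh : IsInvariantDensity T h) : LogLipschitz a (hh.1.toL1 h) := by
  obtain ⟨f, hcone, hmass, hfix⟩ := (hT.contractsCone ha).exists_fixed
  obtain ⟨-, hmass', hfix'⟩ := (T.isInvariantDensity_iff hh.1).1 hh
  rwa [eq_of_fixed_of_pairing_one_eq T.eventually_contractsCone_transfer.frequently hfix' hfix
    (hmass'.trans hmass.symm)]

theorem l1Norm_sub_le_of_isInvariantDensity (hS : S.HasBounds lam B) (hT : T.HasBounds lam B)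
    (ha : a / lam + B < a) {ε : ℝ} (h₀ : ∀ x, ‖T x - S x‖ ≤ ε)
    (h₁ : ∀ x, |deriv T.lift x - deriv S.lift x| ≤ ε) {f g : UnitAddCircle → ℝ}
    (hf : IsInvariantDensity S f) (hg : IsInvariantDensity T g) (n : ℕ) :
    l1Norm (fun x => f x - g x) ≤
      2 * (1 - couplingRate a (a / lam + B)) ^ n + n * ((4 + B + a) * ε) := by
  have hcone := hT.contractsCone ha
  have hf_cone := hS.logLipschitz_of_isInvariantDensity ha hf
  obtain ⟨hf_nonneg, hf_mass, hf_fix⟩ := (S.isInvariantDensity_iff hf.1).1 hf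
  obtain ⟨-, hg_mass, hg_fix⟩ := (T.isInvariantDensity_iff hg.1).1 hg
  have hmove : ‖T.transfer (hf.1.toL1 f) - hf.1.toL1 f‖ ≤ (4 + B + a) * ε := by
    have hle := hS.norm_transfer_sub_le h₀ h₁
      (hf_cone.hasVariationLE (hcone.pos.trans hcone.lt).le)
    rw [norm_eq_pairing_one hf_nonneg, hf_mass, hf_fix] at hle
    linarith
  have hstab := hcone.norm_sub_fixed_le hf_cone (hT.logLipschitz_of_isInvariantDensity ha hg)
    (hf_mass.trans hg_mass.symm) hg_fix n
  rw [hf_mass, mul_one] at hstab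
  rw [l1Norm_sub_eq_norm_sub hf.1 hg.1]
  exact hstab.trans (by gcongr)

end ExpandingCircleMap.HasBounds

theorem exists_l1Norm_transferOp_sub_le (S : ExpandingCircleMap) :
    ∃ C, ∀ (T : ExpandingCircleMap) (ε : ℝ), 0 ≤ ε → c2Dist T S ≤ ENNReal.ofReal ε →
      ∀ f f' : UnitAddCircle → ℝ, HasW11Deriv f f' →
        l1Norm (fun x => transferOp T f x - transferOp S f x) ≤
          C * ε * (l1Norm f + l1Norm f') := by
  obtain ⟨lam, B, hS⟩ := S.exists_hasBounds
  refine ⟨4 + B, fun T ε hε h f f' hf => ?_⟩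
  have hBf' : 0 ≤ (3 + B) * l1Norm f' :=
    mul_nonneg (by linarith [hS.nonneg]) hf.hasVariationLE.nonneg
  rw [l1Norm_sub_eq_norm_sub (integrable_transferOp T f) (integrable_transferOp S f),
    ← T.transfer_toL1 hf.integrable, ← S.transfer_toL1 hf.integrable]
  calc _ ≤ ε * ((4 + B) * ‖hf.integrable.toL1 f‖ + l1Norm f') :=
        hS.norm_transfer_sub_le (norm_sub_le_of_c2Dist_le hε h)
          (abs_deriv_lift_sub_le_of_c2Dist_le hε h) hf.hasVariationLE
    _ ≤ ε * ((4 + B) * (l1Norm f + l1Norm f')) := by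
        rw [norm_toL1_eq_l1Norm]
        exact mul_le_mul_of_nonneg_left (by linarith) hε
    _ = (4 + B) * ε * (l1Norm f + l1Norm f') := by ring

theorem exists_l1Norm_sub_le_of_isInvariantDensity (S : ExpandingCircleMap) :
    ∃ q M ε₀ : ℝ, 0 < q ∧ q < 1 ∧ 0 ≤ M ∧ 0 < ε₀ ∧
      ∀ (T : ExpandingCircleMap) (ε : ℝ), 0 ≤ ε → ε ≤ ε₀ → c2Dist T S ≤ ENNReal.ofReal ε →
        ∀ f g : UnitAddCircle → ℝ, IsInvariantDensity S f → IsInvariantDensity T g →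
          ∀ n : ℕ, l1Norm (fun x => f x - g x) ≤ 2 * q ^ n + n * (M * ε) := by
  obtain ⟨lam, B, hS⟩ := S.exists_hasBounds
  have hlam := hS.one_lt
  have hB := hS.nonneg
  set ε₀ := (lam - 1) / 2 with hε₀_def
  have hε₀ : 0 < ε₀ := by linarith
  have hnear : ∀ {T : ExpandingCircleMap} {ε : ℝ}, 0 ≤ ε → ε ≤ ε₀ →
      c2Dist T S ≤ ENNReal.ofReal ε → T.HasBounds (lam - ε₀) (B + ε₀) := fun hε hle h =>
    hS.of_near (fun x => (abs_deriv_lift_sub_le_of_c2Dist_le hε h x).trans hle)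
      (fun x => (abs_deriv_deriv_lift_sub_le_of_c2Dist_le hε h x).trans hle) (by linarith)
  have hS' : S.HasBounds (lam - ε₀) (B + ε₀) := hnear le_rfl hε₀.le (by simp [c2Dist])
  obtain ⟨a, ha⟩ := (ExpandingCircleMap.eventually_div_add_lt hS'.one_lt (B + ε₀)).exists
  have hcone := hS'.contractsCone ha
  have ha₀ : 0 < a := hcone.pos.trans hcone.lt
  exact ⟨1 - couplingRate a _, 4 + (B + ε₀) + a, ε₀,
    sub_pos.2 (couplingRate_lt_one hcone.pos hcone.lt),
    sub_lt_self 1 (couplingRate_pos hcone.pos hcone.lt), by positivity, hε₀,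
    fun T ε hε hle h f g hf hg => hS'.l1Norm_sub_le_of_isInvariantDensity (hnear hε hle h) ha
      (norm_sub_le_of_c2Dist_le hε h) (abs_deriv_lift_sub_le_of_c2Dist_le hε h) hf hg⟩

/- Take `n = ⌈log δ / log q⌉`, so that `q ^ n ≤ δ` and `n = O(|log δ|)`. -/
theorem isBigO_mul_log_of_forall_le {u : ℝ → ℝ} {q M : ℝ} (hq₀ : 0 < q) (hq₁ : q < 1)
    (hM : 0 ≤ M) (hu₀ : ∀ δ, 0 ≤ u δ)
    (hu : ∀ᶠ δ in 𝓝[>] (0 : ℝ), ∀ n : ℕ, u δ ≤ 2 * q ^ n + n * (M * δ)) :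
    u =O[𝓝[>] (0 : ℝ)] fun δ => δ * Real.log δ := by
  have hlogq : Real.log q < 0 := Real.log_neg hq₀ hq₁
  refine IsBigO.of_bound (2 + M * (-Real.log q)⁻¹ + M) ?_
  filter_upwards [hu, Ioo_mem_nhdsGT (Real.exp_pos (-1))] with δ hδ ⟨hδ₀, hδ₁⟩
  have hlog : 1 ≤ -Real.log δ := by
    linarith [(Real.log_lt_log hδ₀ hδ₁).trans_eq (Real.log_exp _)]
  set r := -Real.log δ * (-Real.log q)⁻¹ with hr
  have hr₀ : 0 ≤ r := mul_nonneg (by linarith) (inv_nonneg.2 (by linarith))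
  have hpow : q ^ ⌈r⌉₊ ≤ δ := by
    rw [← Real.log_le_log_iff (pow_pos hq₀ _) hδ₀, Real.log_pow]
    calc ⌈r⌉₊ * Real.log q ≤ r * Real.log q :=
          mul_le_mul_of_nonpos_right (Nat.le_ceil r) hlogq.le
      _ = Real.log δ := by rw [hr, inv_neg, neg_mul_neg, inv_mul_cancel_right₀ hlogq.ne]
  have hδlog : δ ≤ δ * -Real.log δ := le_mul_of_one_le_right hδ₀.le hlog
  rw [Real.norm_of_nonneg (hu₀ δ), norm_mul, Real.norm_of_nonneg hδ₀.le, Real.norm_eq_abs,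
    abs_of_neg (by linarith : Real.log δ < 0)]
  calc u δ ≤ 2 * q ^ ⌈r⌉₊ + ⌈r⌉₊ * (M * δ) := hδ _
    _ ≤ 2 * δ + (r + 1) * (M * δ) := by
        gcongr
        exact (Nat.ceil_lt_add_one hr₀).le
    _ = 2 * δ + M * (-Real.log q)⁻¹ * (δ * -Real.log δ) + M * δ := by rw [hr]; ring
    _ ≤ 2 * (δ * -Real.log δ) + M * (-Real.log q)⁻¹ * (δ * -Real.log δ) +
          M * (δ * -Real.log δ) := by gcongr
    _ = (2 + M * (-Real.log q)⁻¹ + M) * (δ * -Real.log δ) := by ring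

end Stability

end

theorem mainTheorem9 (T : ℝ → ExpandingCircleMap) (K : ℝ)
    (hT : ∀ δ ∈ Set.Icc (0 : ℝ) 1, c2Dist (T δ) (T 0) ≤ ENNReal.ofReal (K * δ)) :
    (∃ C : ℝ, ∀ δ ∈ Set.Icc (0 : ℝ) 1, ∀ f f' : UnitAddCircle → ℝ, HasW11Deriv f f' →
      l1Norm (fun x => transferOp (T δ) f x - transferOp (T 0) f x)
        ≤ C * δ * (l1Norm f + l1Norm f')) ∧
    (∀ δ ∈ Set.Icc (0 : ℝ) 1, ∃ h : UnitAddCircle → ℝ, IsInvariantDensity (T δ) h ∧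
      ∀ g : UnitAddCircle → ℝ, IsInvariantDensity (T δ) g → g =ᵐ[volume] h) ∧
    (∀ h : ℝ → UnitAddCircle → ℝ, (∀ δ ∈ Set.Icc (0 : ℝ) 1, IsInvariantDensity (T δ) (h δ)) →
      (fun δ : ℝ => l1Norm (fun x => h 0 x - h δ x))
        =O[𝓝[>] (0 : ℝ)] (fun δ : ℝ => δ * Real.log δ)) := by
  set k := max K 0
  have hk : 0 ≤ k := le_max_right K 0
  have hdist : ∀ δ ∈ Set.Icc (0 : ℝ) 1, c2Dist (T δ) (T 0) ≤ ENNReal.ofReal (k * δ) :=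
    fun δ hδ => (hT δ hδ).trans (ENNReal.ofReal_le_ofReal
      (mul_le_mul_of_nonneg_right (le_max_left K 0) hδ.1))
  refine ⟨?_, fun δ _ => (T δ).exists_unique_isInvariantDensity, fun h hh => ?_⟩
  · obtain ⟨C, hC⟩ := exists_l1Norm_transferOp_sub_le (T 0)
    refine ⟨C * k, fun δ hδ f f' hf => ?_⟩
    rw [mul_assoc C]
    exact hC _ _ (mul_nonneg hk hδ.1) (hdist δ hδ) f f' hf
  · obtain ⟨q, M, ε₀, hq₀, hq₁, hM, hε₀, hbound⟩ :=
      exists_l1Norm_sub_le_of_isInvariantDensity (T 0)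
    refine isBigO_mul_log_of_forall_le hq₀ hq₁ (mul_nonneg hM hk)
      (fun δ => integral_nonneg fun x => abs_nonneg _) ?_
    have hsmall : Tendsto (fun δ : ℝ => k * δ) (𝓝[>] 0) (𝓝 0) :=
      (Continuous.tendsto' (by fun_prop) 0 0 (mul_zero k)).mono_left nhdsWithin_le_nhds
    filter_upwards [hsmall.eventually_le_const hε₀, Ioo_mem_nhdsGT one_pos] with δ hδ hmem n
    have hIcc : δ ∈ Set.Icc (0 : ℝ) 1 := Set.Ioo_subset_Icc_self hmem
    rw [mul_assoc M]
    exact hbound (T δ) (k * δ) (mul_nonneg hk hIcc.1) hδ (hdist δ hIcc) _ _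
      (hh 0 (Set.left_mem_Icc.2 zero_le_one)) (hh δ hIcc) n
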